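/- Let $\Bbbk$ be a field of characteristic $0$. Operads are symmetric operads $\mathfrak P=(\mathfrak P(n))_{n\ge 1}$ in $\Bbbk$-vector spaces; a $\mathfrak P$-algebra is an algebra over $\mathfrak P$, and a variety of $\mathfrak P$-algebras is a class of $\mathfrak P$-algebras closed under subalgebras, homomorphic images and direct products. Let $\mathrm{ComTrias}$ be the operad for which $\mathrm{ComTrias}(n)$ has the basis $\{e^{(n)}_H : \emptyset\ne H\subseteq\{1,\dots,n\}\}$, with the natural action of $S_n$ and the composition $e^{(m)}_K(e^{(n_1)}_{H_1},\dots,e^{(n_m)}_{H_m})=e^{(n)}_{K(H_1,\dots,H_m)}$, where $n=n_1+\dots+n_m$ and $K(H_1,\dots,H_m)=\{n_1+\dots+n_{i-1}+l : i\in K,\ l\in H_i\}$. For an operad $\mathfrak P$ let $\text{tri-}\mathfrak P=\mathrm{ComTrias}\otimes\mathfrak P$ (Hadamard product: $(\mathrm{ComTrias}\otimes\mathfrak P)(n)=\mathrm{ComTrias}(n)\otimes\mathfrak P(n)$). Let $\omega:\mathfrak N\to\mathfrak M$ be a morphism of operads. For an $\mathfrak M$-algebra $A$ let $A^{(\omega)}$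 be the $\mathfrak N$-algebra on the same space on which $p\in\mathfrak N(n)$ acts as $\omega(p)$. An $\mathfrak N$-algebra $B$ is special with respect to $\omega$ if it is isomorphic to a subalgebra of $A^{(\omega)}$ for some $\mathfrak M$-algebra $A$; $S^{(\omega)}\mathfrak N$ denotes the variety of $\mathfrak N$-algebras generated by all special ones. Likewise $S^{(\mathrm{id}\otimes\omega)}\,\text{tri-}\mathfrak N$ is the variety of $\text{tri-}\mathfrak N$-algebras generated by those that are special with respect to the morphism $\mathrm{id}\otimes\omega:\text{tri-}\mathfrak N\to\text{tri-}\mathfrak M$. For a variety $\mathfrak V$ of $\mathfrak N$-algebras let $\mathrm{Id}(\mathfrak V)$ be the operadic ideal of those $p\in\mathfrak N(n)$, $n\ge1$, that act as zero on every algebra of $\mathfrak V$, and let $\text{tri-}\mathfrak V$ be the class of all $\text{tri-}\mathfrak N$-algebras whose structure comes from the structure of an algebra over $\mathrm{ComTrias}\otimes(\mathfrak N/\mathrm{Id}(\mathfrak V))$ along the natural projection $\text{tri-}\mathfrak N\to\mathrm{ComTrias}\otimes(\mathfrak N/\mathrm{Id}(\mathfrak V))$. Theorem. The following equality of classes of $\text{tri-}\mathfrak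 N$-algebras holds: $$S^{(\mathrm{id}\otimes\omega)}\,\text{tri-}\mathfrak N=\text{tri-}S^{(\omega)}\mathfrak N .$$ -/

import Mathlib

open scoped TensorProduct

universe u

instance sigmaNonempty {ι : Type} [Nonempty ι] {κ : ι → Type} [∀ i, Nonempty (κ i)] :
    Nonempty (Σ i, κ i) :=
  ⟨⟨Classical.arbitrary ι, Classical.arbitrary _⟩⟩

/-- A symmetric operad (without nullary operations) over a field `k`, in its coordinate-free form:
the `S_n`-modules `P(n)`, `n ≥ 1`, are presented as a functor `ι ↦ P(ι)` on nonempty finite sets and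
bijections (`P(n)` is the value at `Fin n`, and `map` restricted to permutations is the `S_n`-action),
and the composition `p(q_1, …, q_n)` of `p ∈ P(ι)` with `q i ∈ P(κ i)` lies in `P(Σ i, κ i)`. -/
structure Operad (k : Type u) [Field k] where
  obj : (ι : Type) → [Finite ι] → [Nonempty ι] → Type u
  [addCommGroup : ∀ (ι : Type) [Finite ι] [Nonempty ι], AddCommGroup (obj ι)]
  [module : ∀ (ι : Type) [Finite ι] [Nonempty ι], Module k (obj ι)]
  /-- relabelling of inputs -/
  map : ∀ {ι κ : Type} [Finite ι] [Nonempty ι] [Finite κ] [Nonempty κ],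
    (ι ≃ κ) → obj ι →ₗ[k] obj κ
  map_refl : ∀ {ι : Type} [Finite ι] [Nonempty ι] (p : obj ι), map (Equiv.refl ι) p = p
  map_trans : ∀ {ι κ μ : Type} [Finite ι] [Nonempty ι] [Finite κ] [Nonempty κ] [Finite μ]
    [Nonempty μ] (e : ι ≃ κ) (f : κ ≃ μ) (p : obj ι), map (e.trans f) p = map f (map e p)
  /-- the identity operation -/
  one : obj Unit
  /-- composition -/
  comp : ∀ {ι : Type} [Finite ι] [Nonempty ι] {κ : ι → Type} [∀ i, Finite (κ i)]
    [∀ i, Nonempty (κ i)],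
    obj ι →ₗ[k] MultilinearMap k (fun i => obj (κ i)) (obj (Σ i, κ i))
  /-- equivariance in the inner operations -/
  comp_map : ∀ {ι : Type} [Finite ι] [Nonempty ι] {κ κ' : ι → Type} [∀ i, Finite (κ i)]
    [∀ i, Nonempty (κ i)] [∀ i, Finite (κ' i)] [∀ i, Nonempty (κ' i)] (e : ∀ i, κ i ≃ κ' i)
    (p : obj ι) (q : ∀ i, obj (κ i)),
    comp p (fun i => map (e i) (q i)) = map (Equiv.sigmaCongrRight e) (comp p q)
  /-- equivariance in the outer operation -/
  map_comp : ∀ {ι ι' : Type} [Finite ι] [Nonempty ι] [Finite ι'] [Nonempty ι'] {κ : ι' → Type}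
    [∀ i, Finite (κ i)] [∀ i, Nonempty (κ i)] (e : ι ≃ ι') (p : obj ι) (q : ∀ i, obj (κ i)),
    comp (map e p) q =
      map (Equiv.sigmaCongrLeft (β := κ) e) (comp (κ := fun i => κ (e i)) p fun i => q (e i))
  comp_assoc : ∀ {ι : Type} [Finite ι] [Nonempty ι] {κ : ι → Type} [∀ i, Finite (κ i)]
    [∀ i, Nonempty (κ i)] {μ : ∀ i, κ i → Type} [∀ i j, Finite (μ i j)] [∀ i j, Nonempty (μ i j)]
    (p : obj ι) (q : ∀ i, obj (κ i)) (r : ∀ i j, obj (μ i j)),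
    map (Equiv.sigmaAssoc μ)
        (comp (κ := fun x : Σ i, κ i => μ x.1 x.2) (comp p q) fun x => r x.1 x.2) =
      comp (κ := fun i => Σ j, μ i j) p fun i => comp (q i) (r i)
  one_comp : ∀ {κ : Type} [Finite κ] [Nonempty κ] (q : obj κ),
    map (Equiv.uniqueSigma fun _ : Unit => κ) (comp (κ := fun _ : Unit => κ) one fun _ => q) = q
  comp_one : ∀ {ι : Type} [Finite ι] [Nonempty ι] (p : obj ι),
    map (Equiv.sigmaPUnit ι) (comp (κ := fun _ : ι => Unit) p fun _ => one) = p

attribute [instance] Operad.addCommGroup Operad.module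

namespace Operad

variable {k : Type u} [Field k]

/-- A morphism of operads. -/
structure Hom (P Q : Operad k) where
  app : ∀ {ι : Type} [Finite ι] [Nonempty ι], P.obj ι →ₗ[k] Q.obj ι
  app_map : ∀ {ι κ : Type} [Finite ι] [Nonempty ι] [Finite κ] [Nonempty κ] (e : ι ≃ κ)
    (p : P.obj ι), app (P.map e p) = Q.map e (app p)
  app_one : app P.one = Q.one
  app_comp : ∀ {ι : Type} [Finite ι] [Nonempty ι] {κ : ι → Type} [∀ i, Finite (κ i)]
    [∀ i, Nonempty (κ i)] (p : P.obj ι) (q : ∀ i, P.obj (κ i)),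
    app (P.comp p q) = Q.comp (app p) fun i => app (q i)

/-- The identity morphism. -/
def Hom.id (P : Operad k) : Hom P P where
  app := LinearMap.id
  app_map _ _ := rfl
  app_one := rfl
  app_comp _ _ := rfl

end Operad

/-! ### Algebras over an operad -/

/-- An algebra over the operad `P`: every `p ∈ P(ι)` acts as a multilinear operation. -/
structure OperadAlgebra {k : Type u} [Field k] (P : Operad k) where
  carrier : Type u
  [addCommGroup : AddCommGroup carrier]
  [module : Module k carrier]
  act : ∀ {ι : Type} [Finite ι] [Nonempty ι],
    P.obj ι →ₗ[k] MultilinearMap k (fun _ : ι => carrier) carrier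
  act_map : ∀ {ι κ : Type} [Finite ι] [Nonempty ι] [Finite κ] [Nonempty κ] (e : ι ≃ κ)
    (p : P.obj ι) (v : κ → carrier), act (P.map e p) v = act p fun i => v (e i)
  act_one : ∀ v : Unit → carrier, act P.one v = v ()
  act_comp : ∀ {ι : Type} [Finite ι] [Nonempty ι] {κ : ι → Type} [∀ i, Finite (κ i)]
    [∀ i, Nonempty (κ i)] (p : P.obj ι) (q : ∀ i, P.obj (κ i)) (v : (Σ i, κ i) → carrier),
    act (P.comp p q) v = act p fun i => act (q i) fun j => v ⟨i, j⟩

attribute [instance] OperadAlgebra.addCommGroup OperadAlgebra.module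

namespace OperadAlgebra

variable {k : Type u} [Field k] {P Q : Operad k}

/-- A linear map is a homomorphism if it commutes with all operations. -/
def IsHom (A B : OperadAlgebra P) (f : A.carrier →ₗ[k] B.carrier) : Prop :=
  ∀ {ι : Type} [Finite ι] [Nonempty ι] (p : P.obj ι) (v : ι → A.carrier),
    f (A.act p v) = B.act p fun i => f (v i)

/-- `A` is isomorphic to a subalgebra of `B`. -/
def Embeds (A B : OperadAlgebra P) : Prop :=
  ∃ f : A.carrier →ₗ[k] B.carrier, IsHom A B f ∧ Function.Injective f

/-- `B` is a homomorphic image of `A`. -/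
def MapsOnto (A B : OperadAlgebra P) : Prop :=
  ∃ f : A.carrier →ₗ[k] B.carrier, IsHom A B f ∧ Function.Surjective f

/-- `A` and `B` are isomorphic. -/
def Isomorphic (A B : OperadAlgebra P) : Prop :=
  ∃ f : A.carrier →ₗ[k] B.carrier, IsHom A B f ∧ Function.Bijective f

/-- The direct product of a family of algebras, with componentwise operations. -/
def pi {J : Type u} (A : J → OperadAlgebra P) : OperadAlgebra P where
  carrier := ∀ j, (A j).carrier
  act {ι} _ _ :=
    { toFun := fun p => MultilinearMap.pi fun j =>
        ((A j).act p).compLinearMap fun _ => LinearMap.proj j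
      map_add' := fun p q => by ext; simp
      map_smul' := fun c p => by ext; simp }
  act_map e p v := by ext j; simp [act_map]
  act_one v := by ext j; simp [act_one]
  act_comp p q v := by ext j; simp [act_comp]

/-- Given `ω : Q → P` and a `P`-algebra `A`, the `Q`-algebra `A^(ω)` on the same space. -/
def restrict (ω : Operad.Hom Q P) (A : OperadAlgebra P) : OperadAlgebra Q where
  carrier := A.carrier
  act := A.act ∘ₗ ω.app
  act_map e p v := by simp [ω.app_map, A.act_map]
  act_one v := by simp [ω.app_one, A.act_one]
  act_comp p q v := by simp [ω.app_comp, A.act_comp]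

/-! ### Varieties -/

/-- A class of `P`-algebras is a variety if it is closed under subalgebras, homomorphic images and
direct products (and in particular under isomorphisms). -/
structure IsVariety (V : Set (OperadAlgebra P)) : Prop where
  sub : ∀ A B : OperadAlgebra P, Embeds A B → B ∈ V → A ∈ V
  quot : ∀ A B : OperadAlgebra P, MapsOnto A B → A ∈ V → B ∈ V
  prod : ∀ (J : Type u) (A : J → OperadAlgebra P), (∀ j, A j ∈ V) → pi A ∈ V

/-- The variety generated by a class of algebras: the smallest variety containing it. -/
def generatedVariety (K : Set (OperadAlgebra P)) : Set (OperadAlgebra P) :=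
  {A | ∀ V : Set (OperadAlgebra P), IsVariety V → K ⊆ V → A ∈ V}

/-- `B` is special with respect to `ω : Q → P` if it is a subalgebra of `A^(ω)` for some
`P`-algebra `A`. -/
def IsSpecial (ω : Operad.Hom Q P) (B : OperadAlgebra Q) : Prop :=
  ∃ A : OperadAlgebra P, Embeds B (A.restrict ω)

/-- The variety generated by all algebras that are special with respect to `ω`. -/
def specialVariety (ω : Operad.Hom Q P) : Set (OperadAlgebra Q) :=
  generatedVariety {B | IsSpecial ω B}

end OperadAlgebra
namespace Operad

variable {k : Type u} [Field k]

/-! ### Quotient operads and the operad governing a variety -/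

/-- An operadic ideal. -/
structure OperadIdeal (P : Operad k) where
  carrier : ∀ (ι : Type) [Finite ι] [Nonempty ι], Submodule k (P.obj ι)
  map_mem : ∀ {ι κ : Type} [Finite ι] [Nonempty ι] [Finite κ] [Nonempty κ] (e : ι ≃ κ)
    {p : P.obj ι}, p ∈ carrier ι → P.map e p ∈ carrier κ
  comp_mem_left : ∀ {ι : Type} [Finite ι] [Nonempty ι] {κ : ι → Type} [∀ i, Finite (κ i)]
    [∀ i, Nonempty (κ i)] {p : P.obj ι} (q : ∀ i, P.obj (κ i)),
    p ∈ carrier ι → P.comp p q ∈ carrier (Σ i, κ i)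
  comp_mem_right : ∀ {ι : Type} [Finite ι] [Nonempty ι] {κ : ι → Type} [∀ i, Finite (κ i)]
    [∀ i, Nonempty (κ i)] (p : P.obj ι) (q : ∀ i, P.obj (κ i)) (i : ι),
    q i ∈ carrier (κ i) → P.comp p q ∈ carrier (Σ i, κ i)

/-- A multilinear map that depends on its arguments only modulo submodules descends to the
quotients. -/
noncomputable def multilinearQuotient {ι : Type} {E : ι → Type u} {F : Type u}
    [∀ i, AddCommGroup (E i)] [∀ i, Module k (E i)] [AddCommGroup F] [Module k F]
    (S : ∀ i, Submodule k (E i)) (f : MultilinearMap k E F)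
    (hf : ∀ x y : ∀ i, E i, (∀ i, x i - y i ∈ S i) → f x = f y) :
    MultilinearMap k (fun i => E i ⧸ S i) F where
  toFun x := f fun i => (x i).out
  map_update_add' x i a b := by
    have key : ∀ c : E i ⧸ S i, ∀ d : E i, (S i).mkQ d = c →
        (f fun j => (Function.update x i c j).out) =
          f (Function.update (fun j => (x j).out) i d) := by
      intro c d h
      apply hf
      intro j
      by_cases hj : j = i
      · subst hj
        simp only [Function.update_self]
        rw [← (Submodule.Quotient.eq _), ← h]
        exact Quotient.out_eq _
      · simp [Function.update_of_ne hj]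
    have ha : (S i).mkQ a.out = a := Quotient.out_eq _
    have hb : (S i).mkQ b.out = b := Quotient.out_eq _
    rw [key (a + b) (a.out + b.out) (by rw [map_add, ha, hb]), key a _ ha, key b _ hb,
      f.map_update_add]
  map_update_smul' x i c a := by
    have key : ∀ c : E i ⧸ S i, ∀ d : E i, (S i).mkQ d = c →
        (f fun j => (Function.update x i c j).out) =
          f (Function.update (fun j => (x j).out) i d) := by
      intro c d h
      apply hf
      intro j
      by_cases hj : j = i
      · subst hj
        simp only [Function.update_self]
        rw [← (Submodule.Quotient.eq _), ← h]
        exact Quotient.out_eq _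
      · simp [Function.update_of_ne hj]
    have ha : (S i).mkQ a.out = a := Quotient.out_eq _
    rw [key (c • a) (c • a.out) (by rw [map_smul, ha]), key a _ ha, f.map_update_smul]

theorem multilinearQuotient_mk {ι : Type} {E : ι → Type u} {F : Type u}
    [∀ i, AddCommGroup (E i)] [∀ i, Module k (E i)] [AddCommGroup F] [Module k F]
    (S : ∀ i, Submodule k (E i)) (f : MultilinearMap k E F)
    (hf : ∀ x y : ∀ i, E i, (∀ i, x i - y i ∈ S i) → f x = f y) (x : ∀ i, E i) :
    multilinearQuotient S f hf (fun i => (S i).mkQ (x i)) = f x := by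
  apply hf
  intro i
  rw [← (Submodule.Quotient.eq _)]
  exact Quotient.out_eq _

namespace OperadIdeal

variable {P : Operad k} (I : OperadIdeal P)

theorem comp_sub_mem {ι : Type} [Finite ι] [Nonempty ι] {κ : ι → Type} [∀ i, Finite (κ i)]
    [∀ i, Nonempty (κ i)] (p : P.obj ι) (q q' : ∀ i, P.obj (κ i))
    (h : ∀ i, q i - q' i ∈ I.carrier (κ i)) :
    P.comp p q - P.comp p q' ∈ I.carrier (Σ i, κ i) := by
  classical
  have := Fintype.ofFinite ι
  have key : ∀ s : Finset ι, P.comp p (s.piecewise q q') - P.comp p q' ∈ I.carrier (Σ i, κ i) := by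
    intro s
    induction s using Finset.induction_on with
    | empty => simp
    | insert a s ha ih =>
      have h1 : P.comp p ((insert a s).piecewise q q') - P.comp p (s.piecewise q q') =
          P.comp p (Function.update (s.piecewise q q') a (q a - q' a)) := by
        rw [Finset.piecewise_insert, MultilinearMap.map_update_sub]
        congr 2
        rw [← Finset.piecewise_eq_of_notMem s q q' ha, Function.update_eq_self]
      have h2 : P.comp p ((insert a s).piecewise q q') - P.comp p (s.piecewise q q') ∈
          I.carrier (Σ i, κ i) := by
        rw [h1]
        apply I.comp_mem_right p _ a
        simpa using h a
      have := Submodule.add_mem _ h2 ih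
      simpa using this
  simpa using key Finset.univ

theorem mk_comp_congr {ι : Type} [Finite ι] [Nonempty ι] {κ : ι → Type} [∀ i, Finite (κ i)]
    [∀ i, Nonempty (κ i)] (p : P.obj ι) (q q' : ∀ i, P.obj (κ i))
    (h : ∀ i, q i - q' i ∈ I.carrier (κ i)) :
    (I.carrier (Σ i, κ i)).mkQ.compMultilinearMap (P.comp p) q =
      (I.carrier (Σ i, κ i)).mkQ.compMultilinearMap (P.comp p) q' := by
  simpa using (Submodule.Quotient.eq _).2 (I.comp_sub_mem p q q' h)

/-- The composition of the quotient operad, on classes of elements. -/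
noncomputable def quotientComp {ι : Type} [Finite ι] [Nonempty ι] {κ : ι → Type}
    [∀ i, Finite (κ i)] [∀ i, Nonempty (κ i)] :
    (P.obj ι ⧸ I.carrier ι) →ₗ[k]
      MultilinearMap k (fun i => P.obj (κ i) ⧸ I.carrier (κ i))
        (P.obj (Σ i, κ i) ⧸ I.carrier (Σ i, κ i)) :=
  (I.carrier ι).liftQ
    { toFun := fun p => multilinearQuotient (fun i => I.carrier (κ i))
        ((I.carrier (Σ i, κ i)).mkQ.compMultilinearMap (P.comp p)) (I.mk_comp_congr p)
      map_add' := fun p q => by ext x; simp [multilinearQuotient]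
      map_smul' := fun c p => by ext x; simp [multilinearQuotient] }
    (fun p hp => by
      ext x
      simpa [multilinearQuotient] using I.comp_mem_left _ hp)

theorem quotientComp_mk {ι : Type} [Finite ι] [Nonempty ι] {κ : ι → Type}
    [∀ i, Finite (κ i)] [∀ i, Nonempty (κ i)] (p : P.obj ι) (q : ∀ i, P.obj (κ i)) :
    I.quotientComp ((I.carrier ι).mkQ p) (fun i => (I.carrier (κ i)).mkQ (q i)) =
      (I.carrier (Σ i, κ i)).mkQ (P.comp p q) :=
  multilinearQuotient_mk (fun i => I.carrier (κ i))
    ((I.carrier (Σ i, κ i)).mkQ.compMultilinearMap (P.comp p)) (I.mk_comp_congr p) q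

/-- The quotient operad `P / I`. -/
noncomputable def quotient : Operad k where
  obj ι _ _ := P.obj ι ⧸ I.carrier ι
  map {ι κ} _ _ _ _ e := (I.carrier ι).mapQ (I.carrier κ) (P.map e) fun _ hp => I.map_mem e hp
  map_refl {ι} _ _ p := by
    obtain ⟨p, rfl⟩ := (I.carrier ι).mkQ_surjective p
    simp [P.map_refl]
  map_trans {ι _ _} _ _ _ _ _ _ e f p := by
    obtain ⟨p, rfl⟩ := (I.carrier ι).mkQ_surjective p
    simp [P.map_trans]
  one := (I.carrier Unit).mkQ P.one
  comp := I.quotientComp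
  comp_map {ι} _ _ {κ κ'} _ _ _ _ e p q := by
    obtain ⟨p, rfl⟩ := (I.carrier ι).mkQ_surjective p
    choose q' hq using fun i => (I.carrier (κ i)).mkQ_surjective (q i)
    obtain rfl : (fun i => (I.carrier (κ i)).mkQ (q' i)) = q := funext hq
    rw [quotientComp_mk]
    have := I.quotientComp_mk p fun i => P.map (e i) (q' i)
    rw [P.comp_map] at this
    exact this
  map_comp {ι ι'} _ _ _ _ {κ} _ _ e p q := by
    obtain ⟨p, rfl⟩ := (I.carrier ι).mkQ_surjective p
    choose q' hq using fun i => (I.carrier (κ i)).mkQ_surjective (q i)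
    obtain rfl : (fun i => (I.carrier (κ i)).mkQ (q' i)) = q := funext hq
    have h1 := I.quotientComp_mk (κ := fun i => κ (e i)) p fun i => q' (e i)
    have h2 := I.quotientComp_mk (P.map e p) q'
    rw [P.map_comp] at h2
    rw [h1]
    exact h2
  comp_assoc {ι} _ _ {κ} _ _ {μ} _ _ p q r := by
    obtain ⟨p, rfl⟩ := (I.carrier ι).mkQ_surjective p
    choose q' hq using fun i => (I.carrier (κ i)).mkQ_surjective (q i)
    obtain rfl : (fun i => (I.carrier (κ i)).mkQ (q' i)) = q := funext hq
    choose r' hr using fun i j => (I.carrier (μ i j)).mkQ_surjective (r i j)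
    obtain rfl : (fun i j => (I.carrier (μ i j)).mkQ (r' i j)) = r :=
      funext fun i => funext fun j => hr i j
    have h0 := I.quotientComp_mk p q'
    have h1 := I.quotientComp_mk (κ := fun x : Σ i, κ i => μ x.1 x.2) (P.comp p q')
      fun x => r' x.1 x.2
    have h2 : ∀ i, _ := fun i => I.quotientComp_mk (q' i) (r' i)
    have h3 := I.quotientComp_mk (κ := fun i => Σ j, μ i j) p fun i => P.comp (q' i) (r' i)
    rw [h0, h1, funext h2, h3, ← P.comp_assoc]
    rfl
  one_comp {κ} _ _ q := by
    obtain ⟨q, rfl⟩ := (I.carrier κ).mkQ_surjective q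
    have h := I.quotientComp_mk (κ := fun _ : Unit => κ) P.one fun _ => q
    rw [h]
    conv_rhs => rw [← P.one_comp q]
    rfl
  comp_one {ι} _ _ p := by
    obtain ⟨p, rfl⟩ := (I.carrier ι).mkQ_surjective p
    have h := I.quotientComp_mk (κ := fun _ : ι => Unit) p fun _ => P.one
    rw [h]
    conv_rhs => rw [← P.comp_one p]
    rfl

/-- The projection `P → P / I`. -/
noncomputable def proj : Hom P I.quotient where
  app {ι} _ _ := (I.carrier ι).mkQ
  app_map _ _ := rfl
  app_one := rfl
  app_comp p q := (I.quotientComp_mk p q).symm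

end OperadIdeal

/-- The ideal of all polylinear identities that hold on every algebra of the class `V`. -/
def identities {P : Operad k} (V : Set (OperadAlgebra P)) : OperadIdeal P where
  carrier ι _ _ :=
    { carrier := {p | ∀ A ∈ V, ∀ v : ι → A.carrier, A.act p v = 0}
      add_mem' := fun hp hq A hA v => by simp [hp A hA v, hq A hA v]
      zero_mem' := fun A hA v => by simp
      smul_mem' := fun c p hp A hA v => by simp [hp A hA v] }
  map_mem e p hp A hA v := by rw [A.act_map]; exact hp A hA _
  comp_mem_left q hp A hA v := by rw [A.act_comp]; exact hp A hA _
  comp_mem_right p q i hq A hA v := by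
    rw [A.act_comp]
    exact (A.act p).map_coord_zero i (hq A hA _)

/-! ### The Hadamard product -/

/-- Evaluation of multilinear maps at a fixed argument. -/
def evalMultilinear {ι : Type} {E : ι → Type u} {F : Type u} [∀ i, AddCommGroup (E i)]
    [∀ i, Module k (E i)] [AddCommGroup F] [Module k F] (x : ∀ i, E i) :
    MultilinearMap k E F →ₗ[k] F where
  toFun f := f x
  map_add' _ _ := rfl
  map_smul' _ _ := rfl

section Tensor

variable {ι : Type} [Finite ι] {E F : ι → Type u} [∀ i, AddCommGroup (E i)] [∀ i, Module k (E i)]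
  [∀ i, AddCommGroup (F i)] [∀ i, Module k (F i)]

/-- The map `⨂ (E i ⊗ F i) → (⨂ E i) ⊗ (⨂ F i)` that separates the factors; it is determined by
its values on pure tensors, see `separate_tprod`. -/
noncomputable def separate :
    (PiTensorProduct k fun i => E i ⊗[k] F i) →ₗ[k] (PiTensorProduct k E) ⊗[k] (PiTensorProduct k F) :=
  (Basis.piTensorProduct fun i => (Module.Basis.ofVectorSpace k (E i)).tensorProduct
    (Module.Basis.ofVectorSpace k (F i))).constr k fun v =>
      (PiTensorProduct.tprod k fun i => Module.Basis.ofVectorSpace k (E i) (v i).1) ⊗ₜ[k]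
        (PiTensorProduct.tprod k fun i => Module.Basis.ofVectorSpace k (F i) (v i).2)

theorem separate_tprod (x : ∀ i, E i) (y : ∀ i, F i) :
    separate (PiTensorProduct.tprod k fun i => x i ⊗ₜ[k] y i) =
      (PiTensorProduct.tprod k x) ⊗ₜ[k] (PiTensorProduct.tprod k y) := by
  have h0 : ∀ (v : ∀ i, Module.Basis.ofVectorSpaceIndex k (E i))
      (w : ∀ i, Module.Basis.ofVectorSpaceIndex k (F i)),
      separate (PiTensorProduct.tprod k fun i => Module.Basis.ofVectorSpace k (E i) (v i) ⊗ₜ[k]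
        Module.Basis.ofVectorSpace k (F i) (w i)) =
      (PiTensorProduct.tprod k fun i => Module.Basis.ofVectorSpace k (E i) (v i)) ⊗ₜ[k]
        (PiTensorProduct.tprod k fun i => Module.Basis.ofVectorSpace k (F i) (w i)) := by
    intro v w
    have := (Basis.piTensorProduct fun i => (Module.Basis.ofVectorSpace k (E i)).tensorProduct
      (Module.Basis.ofVectorSpace k (F i))).constr_basis k (fun v =>
      (PiTensorProduct.tprod k fun i => Module.Basis.ofVectorSpace k (E i) (v i).1) ⊗ₜ[k]
        (PiTensorProduct.tprod k fun i => Module.Basis.ofVectorSpace k (F i) (v i).2))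
        (fun i => (v i, w i))
    rw [Basis.piTensorProduct_apply] at this
    simp only [Module.Basis.tensorProduct_apply] at this
    exact this
  have h1 : ∀ (v : ∀ i, Module.Basis.ofVectorSpaceIndex k (E i)) (y : ∀ i, F i),
      separate (PiTensorProduct.tprod k fun i => Module.Basis.ofVectorSpace k (E i) (v i) ⊗ₜ[k]
        y i) =
      (PiTensorProduct.tprod k fun i => Module.Basis.ofVectorSpace k (E i) (v i)) ⊗ₜ[k]
        (PiTensorProduct.tprod k y) := by
    intro v y
    have := Module.Basis.ext_multilinear (R := k) (M := F)
      (f := (separate.compMultilinearMap (PiTensorProduct.tprod k)).compLinearMap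
        fun i => TensorProduct.mk k (E i) (F i) (Module.Basis.ofVectorSpace k (E i) (v i)))
      (g := (TensorProduct.mk k _ _ (PiTensorProduct.tprod k fun i =>
        Module.Basis.ofVectorSpace k (E i) (v i))).compMultilinearMap (PiTensorProduct.tprod k))
      (fun i => Module.Basis.ofVectorSpace k (F i)) (fun w => h0 v w)
    exact MultilinearMap.congr_fun this y
  have := Module.Basis.ext_multilinear (R := k) (M := E)
    (f := (separate.compMultilinearMap (PiTensorProduct.tprod k)).compLinearMap
      fun i => (TensorProduct.mk k (E i) (F i)).flip (y i))
    (g := ((TensorProduct.mk k _ _).flip (PiTensorProduct.tprod k y)).compMultilinearMap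
      (PiTensorProduct.tprod k))
    (fun i => Module.Basis.ofVectorSpace k (E i)) (fun v => h1 v y)
  exact MultilinearMap.congr_fun this x

/-- Multilinear maps on tensor products are determined by their values on pure tensors. -/
theorem multilinear_tensor_ext {G : Type u} [AddCommGroup G] [Module k G]
    {f g : MultilinearMap k (fun i => E i ⊗[k] F i) G}
    (h : ∀ (x : ∀ i, E i) (y : ∀ i, F i), f (fun i => x i ⊗ₜ[k] y i) = g fun i => x i ⊗ₜ[k] y i) :
    f = g :=
  Module.Basis.ext_multilinear (fun i => (Module.Basis.ofVectorSpace k (E i)).tensorProduct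
    (Module.Basis.ofVectorSpace k (F i))) fun v => by
      simpa only [Module.Basis.tensorProduct_apply'] using h _ _

end Tensor

section Hadamard

variable (P Q : Operad k)

/-- The composition `(p ⊗ q)(p_i ⊗ q_i) = p(p_i) ⊗ q(q_i)`, see `hadamardComp_tmul`. -/
noncomputable def hadamardComp {ι : Type} [Finite ι] [Nonempty ι] {κ : ι → Type}
    [∀ i, Finite (κ i)] [∀ i, Nonempty (κ i)] :
    (P.obj ι ⊗[k] Q.obj ι) →ₗ[k] MultilinearMap k (fun i => P.obj (κ i) ⊗[k] Q.obj (κ i))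
      (P.obj (Σ i, κ i) ⊗[k] Q.obj (Σ i, κ i)) :=
  (PiTensorProduct.lift (R := k)).symm.toLinearMap ∘ₗ LinearMap.lcomp k _ separate ∘ₗ
    TensorProduct.homTensorHomMap (RingHom.id k) _ _ _ _ ∘ₗ
      TensorProduct.map ((PiTensorProduct.lift (R := k)).toLinearMap ∘ₗ P.comp (κ := κ))
        ((PiTensorProduct.lift (R := k)).toLinearMap ∘ₗ Q.comp (κ := κ))

theorem hadamardComp_tmul {ι : Type} [Finite ι] [Nonempty ι] {κ : ι → Type}
    [∀ i, Finite (κ i)] [∀ i, Nonempty (κ i)] (p : P.obj ι) (q : Q.obj ι)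
    (p' : ∀ i, P.obj (κ i)) (q' : ∀ i, Q.obj (κ i)) :
    hadamardComp P Q (p ⊗ₜ[k] q) (fun i => p' i ⊗ₜ[k] q' i) =
      P.comp p p' ⊗ₜ[k] Q.comp q q' := by
  simp [hadamardComp, separate_tprod]

/-- The Hadamard product of operads: `(P ⊗ Q)(n) = P(n) ⊗ Q(n)` with componentwise structure. -/
noncomputable def hadamard : Operad k where
  obj ι _ _ := P.obj ι ⊗[k] Q.obj ι
  map e := TensorProduct.map (P.map e) (Q.map e)
  map_refl p := by
    induction p using TensorProduct.induction_on with
    | zero => simp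
    | tmul x y => simp [P.map_refl, Q.map_refl]
    | add x y hx hy => rw [map_add, hx, hy]
  map_trans e f p := by
    induction p using TensorProduct.induction_on with
    | zero => simp
    | tmul x y => simp [P.map_trans, Q.map_trans]
    | add x y hx hy => simp only [map_add, hx, hy]
  one := P.one ⊗ₜ Q.one
  comp := hadamardComp P Q
  comp_map {ι} _ _ {κ κ'} _ _ _ _ e p q := by
    induction p using TensorProduct.induction_on with
    | zero => simp
    | add x y hx hy => simp only [map_add, _root_.add_apply, hx, hy]
    | tmul p p' =>
      have := multilinear_tensor_ext
        (f := (hadamardComp P Q (κ := κ') (p ⊗ₜ p')).compLinearMap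
          fun i => TensorProduct.map (P.map (e i)) (Q.map (e i)))
        (g := (TensorProduct.map (P.map (Equiv.sigmaCongrRight e))
          (Q.map (Equiv.sigmaCongrRight e))).compMultilinearMap (hadamardComp P Q (p ⊗ₜ p')))
        (fun x y => by
          simp [hadamardComp_tmul, P.comp_map, Q.comp_map])
      exact MultilinearMap.congr_fun this q
  map_comp {ι ι'} _ _ _ _ {κ} _ _ e p q := by
    induction p using TensorProduct.induction_on with
    | zero => simp
    | add x y hx hy => simp only [map_add, _root_.add_apply, hx, hy]
    | tmul p p' =>
      have := multilinear_tensor_ext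
        (f := hadamardComp P Q (κ := κ) (P.map e p ⊗ₜ Q.map e p'))
        (g := (TensorProduct.map (P.map (Equiv.sigmaCongrLeft (β := κ) e))
          (Q.map (Equiv.sigmaCongrLeft (β := κ) e))).compMultilinearMap
            ((MultilinearMap.domDomCongrLinearEquiv' k k
              (fun i => P.obj (κ i) ⊗[k] Q.obj (κ i)) _ e.symm).symm
              (hadamardComp P Q (κ := fun i => κ (e i)) (p ⊗ₜ p'))))
        (fun x y => by
          have h := hadamardComp_tmul P Q (κ := fun i => κ (e i)) p p' (fun i => x (e i))
            fun i => y (e i)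
          rw [hadamardComp_tmul, P.map_comp, Q.map_comp, ← TensorProduct.map_tmul, ← h]
          rfl)
      exact MultilinearMap.congr_fun this q
  comp_assoc {ι} _ _ {κ} _ _ {μ} _ _ p q r := by
    have key : ∀ r : ∀ x : Σ i, κ i, P.obj (μ x.1 x.2) ⊗[k] Q.obj (μ x.1 x.2),
        TensorProduct.map (P.map (Equiv.sigmaAssoc μ)) (Q.map (Equiv.sigmaAssoc μ))
          (hadamardComp P Q (κ := fun x : Σ i, κ i => μ x.1 x.2) (hadamardComp P Q p q) r) =
        hadamardComp P Q (κ := fun i => Σ j, μ i j) p fun i =>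
          hadamardComp P Q (q i) fun j => r ⟨i, j⟩ := by
      intro r
      induction p using TensorProduct.induction_on with
      | zero => simp
      | add x y hx hy => simp only [map_add, _root_.add_apply, hx, hy]
      | tmul p p' =>
        have h2 : ∀ (x : ∀ i, P.obj (κ i)) (y : ∀ i, Q.obj (κ i)),
            TensorProduct.map (P.map (Equiv.sigmaAssoc μ)) (Q.map (Equiv.sigmaAssoc μ))
              (hadamardComp P Q (κ := fun x : Σ i, κ i => μ x.1 x.2)
                (hadamardComp P Q (p ⊗ₜ p') fun i => x i ⊗ₜ y i) r) =
            hadamardComp P Q (κ := fun i => Σ j, μ i j) (p ⊗ₜ p') fun i =>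
              hadamardComp P Q (x i ⊗ₜ y i) fun j => r ⟨i, j⟩ := by
          intro x y
          have := multilinear_tensor_ext
            (f := (TensorProduct.map (P.map (Equiv.sigmaAssoc μ))
              (Q.map (Equiv.sigmaAssoc μ))).compMultilinearMap
              (hadamardComp P Q (κ := fun x : Σ i, κ i => μ x.1 x.2)
                (hadamardComp P Q (p ⊗ₜ p') fun i => x i ⊗ₜ y i)))
            (g := (hadamardComp P Q (κ := fun i => Σ j, μ i j) (p ⊗ₜ p')).compMultilinearMap
              fun i => hadamardComp P Q (κ := μ i) (x i ⊗ₜ y i))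
            (fun z w => by
              have h0 : ∀ i, hadamardComp P Q (κ := μ i) (x i ⊗ₜ y i)
                  (fun j => z ⟨i, j⟩ ⊗ₜ w ⟨i, j⟩) = P.comp (x i) (fun j => z ⟨i, j⟩) ⊗ₜ
                    Q.comp (y i) (fun j => w ⟨i, j⟩) := fun i => hadamardComp_tmul P Q _ _ _ _
              rw [LinearMap.compMultilinearMap_apply, hadamardComp_tmul, hadamardComp_tmul,
                TensorProduct.map_tmul, P.comp_assoc p x fun i j => z ⟨i, j⟩,
                Q.comp_assoc p' y fun i j => w ⟨i, j⟩, ← hadamardComp_tmul]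
              exact congrArg _ (funext fun i => (h0 i).symm))
          exact MultilinearMap.congr_fun this r
        have := multilinear_tensor_ext
          (f := (TensorProduct.map (P.map (Equiv.sigmaAssoc μ))
            (Q.map (Equiv.sigmaAssoc μ)) ∘ₗ (evalMultilinear r ∘ₗ
            hadamardComp P Q (κ := fun x : Σ i, κ i => μ x.1 x.2))).compMultilinearMap
              (hadamardComp P Q (p ⊗ₜ p')))
          (g := (hadamardComp P Q (κ := fun i => Σ j, μ i j) (p ⊗ₜ p')).compLinearMap
            fun i => evalMultilinear (fun j => r ⟨i, j⟩) ∘ₗ hadamardComp P Q (κ := μ i))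
          h2
        exact MultilinearMap.congr_fun this q
    exact key fun x => r x.1 x.2
  one_comp {κ} _ _ q := by
    induction q using TensorProduct.induction_on with
    | zero => 
      rw [(hadamardComp P Q (κ := fun _ : Unit => κ) _).map_coord_zero () rfl, map_zero]
    | tmul x y => 
      have := hadamardComp_tmul P Q (κ := fun _ : Unit => κ) P.one Q.one (fun _ => x) fun _ => y
      rw [this]
      simp [P.one_comp, Q.one_comp]
    | add x y hx hy =>
      conv_rhs => rw [← hx, ← hy, ← map_add]
      congr 1
      have h : ∀ z : P.obj κ ⊗[k] Q.obj κ, (fun _ : Unit => z) = Function.update (fun _ => x) () z :=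
        fun z => by ext; simp
      rw [h x, h y, h (x + y)]
      exact MultilinearMap.map_update_add _ _ _ _ _
  comp_one {ι} _ _ p := by
    induction p using TensorProduct.induction_on with
    | zero => simp
    | tmul x y => 
      have := hadamardComp_tmul P Q (κ := fun _ : ι => Unit) x y (fun _ => P.one) fun _ => Q.one
      rw [this]
      simp [P.comp_one, Q.comp_one]
    | add x y hx hy => simp only [map_add, _root_.add_apply, hx, hy]

end Hadamard

section HadamardHom

variable {P P' Q Q' : Operad k} (φ : Hom P P') (ψ : Hom Q Q')

theorem map_hadamard_map {ι κ : Type} [Finite ι] [Nonempty ι] [Finite κ] [Nonempty κ] (e : ι ≃ κ)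
    (p : P.obj ι ⊗[k] Q.obj ι) :
    TensorProduct.map φ.app ψ.app (TensorProduct.map (P.map e) (Q.map e) p) =
      TensorProduct.map (P'.map e) (Q'.map e) (TensorProduct.map φ.app ψ.app p) := by
  induction p using TensorProduct.induction_on with
  | zero => simp
  | tmul x y => simp [φ.app_map, ψ.app_map]
  | add x y hx hy => simp only [map_add, hx, hy]

theorem map_hadamardComp {ι : Type} [Finite ι] [Nonempty ι] {κ : ι → Type} [∀ i, Finite (κ i)]
    [∀ i, Nonempty (κ i)] (p : P.obj ι ⊗[k] Q.obj ι) (q : ∀ i, P.obj (κ i) ⊗[k] Q.obj (κ i)) :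
    TensorProduct.map φ.app ψ.app (hadamardComp P Q p q) =
      hadamardComp P' Q' (TensorProduct.map φ.app ψ.app p)
        fun i => TensorProduct.map φ.app ψ.app (q i) := by
  induction p using TensorProduct.induction_on with
  | zero => simp
  | add x y hx hy => simp only [map_add, _root_.add_apply, hx, hy]
  | tmul p p' =>
    have := multilinear_tensor_ext
      (f := (TensorProduct.map φ.app ψ.app).compMultilinearMap
        (hadamardComp P Q (κ := κ) (p ⊗ₜ p')))
      (g := (hadamardComp P' Q' (κ := κ) (φ.app p ⊗ₜ ψ.app p')).compLinearMap
        fun i => TensorProduct.map φ.app ψ.app)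
      (fun x y => by simp [hadamardComp_tmul, φ.app_comp, ψ.app_comp])
    exact MultilinearMap.congr_fun this q

/-- The tensor product of morphisms of operads. -/
noncomputable def Hom.hadamard : Hom (P.hadamard Q) (P'.hadamard Q') where
  app := TensorProduct.map φ.app ψ.app
  app_map e p := map_hadamard_map φ ψ e p
  app_one := by
    change TensorProduct.map φ.app ψ.app (P.one ⊗ₜ Q.one) = P'.one ⊗ₜ Q'.one
    rw [TensorProduct.map_tmul, φ.app_one, ψ.app_one]
  app_comp p q := map_hadamardComp φ ψ p q

end HadamardHom

/-! ### The operad ComTrias and replication -/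

/-- The composition `K(H_1, …, H_m)` of nonempty sets: it consists of all inputs `(i, j)` with
`i ∈ K` and `j ∈ H_i`. -/
def subsetComp {ι : Type} {κ : ι → Type} (K : {K : Set ι // K.Nonempty})
    (H : ∀ i, {H : Set (κ i) // H.Nonempty}) : {L : Set (Σ i, κ i) // L.Nonempty} :=
  ⟨{x | x.1 ∈ K.1 ∧ x.2 ∈ (H x.1).1}, by
    obtain ⟨i, hi⟩ := K.2
    obtain ⟨j, hj⟩ := (H i).2
    exact ⟨⟨i, j⟩, hi, hj⟩⟩

/-- Relabelling of a nonempty set of inputs. -/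
def subsetMap {ι κ : Type} (e : ι ≃ κ) (H : {H : Set ι // H.Nonempty}) :
    {H : Set κ // H.Nonempty} :=
  ⟨e '' H.1, H.2.image e⟩

/-- The multilinear extension of the composition of sets, see `corollaComp_single`. -/
noncomputable def corollaComp {ι : Type} [Finite ι] {κ : ι → Type} :
    ({K : Set ι // K.Nonempty} →₀ k) →ₗ[k]
      MultilinearMap k (fun i => {H : Set (κ i) // H.Nonempty} →₀ k)
        ({L : Set (Σ i, κ i) // L.Nonempty} →₀ k) :=
  Finsupp.basisSingleOne.constr k fun K => (PiTensorProduct.lift (R := k)).symm <|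
    (Basis.piTensorProduct fun _ => Finsupp.basisSingleOne).constr k fun H =>
      Finsupp.single (subsetComp K H) 1

theorem corollaComp_single {ι : Type} [Finite ι] {κ : ι → Type} (K : {K : Set ι // K.Nonempty})
    (H : ∀ i, {H : Set (κ i) // H.Nonempty}) :
    corollaComp (Finsupp.single K (1 : k)) (fun i => Finsupp.single (H i) 1) =
      Finsupp.single (subsetComp K H) 1 := by
  have h1 := (Finsupp.basisSingleOne (R := k) (ι := {K : Set ι // K.Nonempty})).constr_basis k
    (fun K => (PiTensorProduct.lift (R := k)).symm <|
      (Basis.piTensorProduct fun i => Finsupp.basisSingleOne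
        (ι := {H : Set (κ i) // H.Nonempty})).constr k fun H =>
          Finsupp.single (subsetComp K H) (1 : k)) K
  have h2 := (Basis.piTensorProduct fun i => Finsupp.basisSingleOne (R := k)
        (ι := {H : Set (κ i) // H.Nonempty})).constr_basis k (fun H =>
          Finsupp.single (subsetComp K H) (1 : k)) H
  rw [Basis.piTensorProduct_apply] at h2
  simp only [Finsupp.coe_basisSingleOne] at h1 h2
  rw [corollaComp, h1]
  exact h2

theorem multilinear_finsupp_ext {ι : Type} [Finite ι] {S : ι → Type} {G : Type u}
    [AddCommGroup G] [Module k G] {f g : MultilinearMap k (fun i => S i →₀ k) G}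
    (h : ∀ x : ∀ i, S i, f (fun i => Finsupp.single (x i) 1) = g fun i => Finsupp.single (x i) 1) :
    f = g :=
  Module.Basis.ext_multilinear (fun _ => Finsupp.basisSingleOne) fun v => by
    simpa only [Finsupp.coe_basisSingleOne] using h v

theorem subsetComp_map {ι : Type} {κ κ' : ι → Type} (e : ∀ i, κ i ≃ κ' i)
    (K : {K : Set ι // K.Nonempty}) (H : ∀ i, {H : Set (κ i) // H.Nonempty}) :
    subsetComp K (fun i => subsetMap (e i) (H i)) =
      subsetMap (Equiv.sigmaCongrRight e) (subsetComp K H) := by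
  apply Subtype.ext
  ext x
  obtain ⟨x, rfl⟩ := (Equiv.sigmaCongrRight e).surjective x
  simp only [subsetMap, (Equiv.injective _).mem_set_image]
  simp [subsetComp]

theorem subsetMap_comp {ι ι' : Type} {κ : ι' → Type} (e : ι ≃ ι')
    (K : {K : Set ι // K.Nonempty}) (H : ∀ i, {H : Set (κ i) // H.Nonempty}) :
    subsetComp (subsetMap e K) H =
      subsetMap (Equiv.sigmaCongrLeft (β := κ) e)
        (subsetComp (κ := fun i => κ (e i)) K fun i => H (e i)) := by
  apply Subtype.ext
  ext ⟨i, j⟩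
  obtain ⟨i, rfl⟩ := e.surjective i
  have h : (⟨e i, j⟩ : Σ i, κ i) = Equiv.sigmaCongrLeft (β := κ) e ⟨i, j⟩ := rfl
  conv_rhs => rw [h]
  simp only [subsetMap, (Equiv.injective _).mem_set_image]
  simp [subsetComp]

theorem subsetComp_assoc {ι : Type} {κ : ι → Type} {μ : ∀ i, κ i → Type}
    (K : {K : Set ι // K.Nonempty}) (H : ∀ i, {H : Set (κ i) // H.Nonempty})
    (L : ∀ x : Σ i, κ i, {L : Set (μ x.1 x.2) // L.Nonempty}) :
    subsetMap (Equiv.sigmaAssoc μ)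
        (subsetComp (κ := fun x : Σ i, κ i => μ x.1 x.2) (subsetComp K H) L) =
      subsetComp (κ := fun i => Σ j, μ i j) K fun i => subsetComp (H i) fun j => L ⟨i, j⟩ := by
  apply Subtype.ext
  ext x
  obtain ⟨x, rfl⟩ := (Equiv.sigmaAssoc μ).surjective x
  simp only [subsetMap, (Equiv.injective _).mem_set_image]
  exact and_assoc

/-- The operad ComTrias: `ComTrias(ι)` has a basis of corollas `e_H`, where `H` runs over the
nonempty subsets of `ι`, and the composition of corollas is the composition of subsets. -/
noncomputable def comTrias (k : Type u) [Field k] : Operad k where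
  obj ι _ _ := {H : Set ι // H.Nonempty} →₀ k
  map e := Finsupp.lmapDomain k k (subsetMap e)
  map_refl p := by
    have h : ∀ ι : Type, subsetMap (Equiv.refl ι) = _root_.id := fun ι => by
      ext1 H
      exact Subtype.ext (Set.image_id _)
    simp [h]
  map_trans e f p := by
    have h : subsetMap (e.trans f) = subsetMap f ∘ subsetMap e := by
      ext1 H
      exact Subtype.ext (Set.image_comp f e _)
    simp [h, Finsupp.mapDomain_comp]
  one := Finsupp.single ⟨Set.univ, Set.univ_nonempty⟩ 1
  comp := corollaComp
  comp_map {ι} _ _ {κ κ'} _ _ _ _ e p q := by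
    induction p using Finsupp.induction_linear with
    | zero => simp
    | add x y hx hy => simp only [map_add, _root_.add_apply, hx, hy]
    | single K c =>
      have := multilinear_finsupp_ext
        (f := (corollaComp (κ := κ') (Finsupp.single K (1 : k))).compLinearMap
          fun i => Finsupp.lmapDomain k k (subsetMap (e i)))
        (g := (Finsupp.lmapDomain k k (subsetMap (Equiv.sigmaCongrRight e))).compMultilinearMap
          (corollaComp (Finsupp.single K (1 : k))))
        (fun H => by simp [corollaComp_single, subsetComp_map])
      have h := MultilinearMap.congr_fun this q
      rw [← mul_one c, ← smul_eq_mul, ← Finsupp.smul_single, map_smul, map_smul,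
        _root_.smul_apply, _root_.smul_apply, map_smul]
      exact congrArg _ h
  map_comp {ι ι'} _ _ _ _ {κ} _ _ e p q := by
    induction p using Finsupp.induction_linear with
    | zero => simp
    | add x y hx hy => simp only [map_add, _root_.add_apply, hx, hy]
    | single K c =>
      have := multilinear_finsupp_ext
        (f := corollaComp (κ := κ) (Finsupp.single (subsetMap e K) (1 : k)))
        (g := (Finsupp.lmapDomain k k
          (subsetMap (Equiv.sigmaCongrLeft (β := κ) e))).compMultilinearMap
            ((MultilinearMap.domDomCongrLinearEquiv' k k
              (fun i => {H : Set (κ i) // H.Nonempty} →₀ k) _ e.symm).symm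
              (corollaComp (κ := fun i => κ (e i)) (Finsupp.single K (1 : k)))))
        (fun H => by
          have h := corollaComp_single (k := k) (κ := fun i => κ (e i)) K fun i => H (e i)
          rw [corollaComp_single, subsetMap_comp, ← Finsupp.mapDomain_single, ← h]
          rfl)
      have h := MultilinearMap.congr_fun this q
      rw [← mul_one c, ← smul_eq_mul, ← Finsupp.smul_single, map_smul, map_smul, map_smul,
        _root_.smul_apply, _root_.smul_apply, map_smul, Finsupp.lmapDomain_apply,
        Finsupp.mapDomain_single]
      exact congrArg _ h
  comp_assoc {ι} _ _ {κ} _ _ {μ} _ _ p q r := by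
    have key : ∀ r : ∀ x : Σ i, κ i, ({L : Set (μ x.1 x.2) // L.Nonempty} →₀ k),
        Finsupp.lmapDomain k k (subsetMap (Equiv.sigmaAssoc μ))
          (corollaComp (κ := fun x : Σ i, κ i => μ x.1 x.2) (corollaComp p q) r) =
        corollaComp (κ := fun i => Σ j, μ i j) p fun i => corollaComp (q i) fun j => r ⟨i, j⟩ := by
      intro r
      induction p using Finsupp.induction_linear with
      | zero => simp
      | add x y hx hy => simp only [map_add, _root_.add_apply, hx, hy]
      | single K c =>
        have h2 : ∀ H : ∀ i, {H : Set (κ i) // H.Nonempty},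
            Finsupp.lmapDomain k k (subsetMap (Equiv.sigmaAssoc μ))
              (corollaComp (κ := fun x : Σ i, κ i => μ x.1 x.2)
                (corollaComp (Finsupp.single K 1) fun i => Finsupp.single (H i) 1) r) =
            corollaComp (κ := fun i => Σ j, μ i j) (Finsupp.single K 1) fun i =>
              corollaComp (Finsupp.single (H i) 1) fun j => r ⟨i, j⟩ := by
          intro H
          have := multilinear_finsupp_ext
            (f := (Finsupp.lmapDomain k k (subsetMap (Equiv.sigmaAssoc μ))).compMultilinearMap
              (corollaComp (κ := fun x : Σ i, κ i => μ x.1 x.2)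
                (corollaComp (Finsupp.single K 1) fun i => Finsupp.single (H i) 1)))
            (g := (corollaComp (κ := fun i => Σ j, μ i j)
              (Finsupp.single K (1 : k))).compMultilinearMap
              fun i => corollaComp (κ := μ i) (Finsupp.single (H i) 1))
            (fun L => by
              have h0 : ∀ i, corollaComp (κ := μ i) (Finsupp.single (H i) (1 : k))
                  (fun j => Finsupp.single (L ⟨i, j⟩) 1) =
                    Finsupp.single (subsetComp (H i) fun j => L ⟨i, j⟩) 1 :=
                fun i => corollaComp_single _ _
              rw [LinearMap.compMultilinearMap_apply, corollaComp_single, corollaComp_single,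
                Finsupp.lmapDomain_apply, Finsupp.mapDomain_single, subsetComp_assoc,
                ← corollaComp_single]
              exact congrArg _ (funext fun i => (h0 i).symm))
          exact MultilinearMap.congr_fun this r
        have := multilinear_finsupp_ext
          (f := (Finsupp.lmapDomain k k (subsetMap (Equiv.sigmaAssoc μ)) ∘ₗ
            (evalMultilinear r ∘ₗ
              corollaComp (κ := fun x : Σ i, κ i => μ x.1 x.2))).compMultilinearMap
              (corollaComp (Finsupp.single K (1 : k))))
          (g := (corollaComp (κ := fun i => Σ j, μ i j)
            (Finsupp.single K (1 : k))).compLinearMap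
            fun i => evalMultilinear (fun j => r ⟨i, j⟩) ∘ₗ corollaComp (κ := μ i))
          h2
        have h := MultilinearMap.congr_fun this q
        rw [← mul_one c, ← smul_eq_mul, ← Finsupp.smul_single, map_smul, map_smul,
          _root_.smul_apply, _root_.smul_apply, map_smul, _root_.smul_apply, map_smul]
        exact congrArg _ h
    exact key fun x => r x.1 x.2
  one_comp {κ} _ _ q := by
    have := multilinear_finsupp_ext (ι := Unit)
      (f := (Finsupp.lmapDomain k k
        (subsetMap (Equiv.uniqueSigma fun _ : Unit => κ))).compMultilinearMap
        (corollaComp (κ := fun _ : Unit => κ)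
          (Finsupp.single ⟨Set.univ, Set.univ_nonempty⟩ (1 : k))))
      (g := MultilinearMap.ofSubsingleton k _ _ () LinearMap.id)
      (fun H => by
        rw [LinearMap.compMultilinearMap_apply, corollaComp_single, Finsupp.lmapDomain_apply,
          Finsupp.mapDomain_single]
        have h : subsetMap (Equiv.uniqueSigma fun _ : Unit => κ)
            (subsetComp ⟨Set.univ, Set.univ_nonempty⟩ H) = H () := by
          apply Subtype.ext
          ext x
          obtain ⟨x, rfl⟩ := (Equiv.uniqueSigma fun _ : Unit => κ).surjective x
          simp only [subsetMap, (Equiv.injective _).mem_set_image]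
          simp [subsetComp, Equiv.uniqueSigma]
        rw [h]
        simp)
    exact MultilinearMap.congr_fun this fun _ => q
  comp_one {ι} _ _ p := by
    induction p using Finsupp.induction_linear with
    | zero => simp
    | add x y hx hy => simp only [map_add, _root_.add_apply, hx, hy]
    | single K c =>
      have h0 := corollaComp_single (k := k) (κ := fun _ : ι => Unit) K
        fun _ => ⟨Set.univ, Set.univ_nonempty⟩
      have h : subsetMap (Equiv.sigmaPUnit ι) (subsetComp (κ := fun _ : ι => Unit) K
          fun _ => ⟨Set.univ, Set.univ_nonempty⟩) = K := by
        apply Subtype.ext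
        ext x
        simp [subsetMap, subsetComp, Equiv.sigmaPUnit]
      rw [← mul_one c, ← smul_eq_mul, ← Finsupp.smul_single, map_smul, _root_.smul_apply,
        map_smul, h0, Finsupp.lmapDomain_apply, Finsupp.mapDomain_single, h]

/-- The operad `tri-P = ComTrias ⊗ P`. -/
noncomputable def tri (P : Operad k) : Operad k :=
  (comTrias k).hadamard P

/-- The morphism `id ⊗ ω : tri-P → tri-Q` induced by a morphism `ω : P → Q`. -/
noncomputable def Hom.tri {P Q : Operad k} (ω : Hom P Q) : Hom P.tri Q.tri :=
  (Hom.id (comTrias k)).hadamard ω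

/-- The variety `tri-V` for a variety `V` of `P`-algebras, as a class of `tri-P`-algebras. The
operad governing `V` is `P / Id(V)`, where `Id(V)` consists of the polylinear identities of `V`, and
`tri-V` is the variety governed by the operad `ComTrias ⊗ (P / Id(V))`, a quotient of `tri-P`. -/
def triVariety {P : Operad k} (V : Set (OperadAlgebra P)) : Set (OperadAlgebra P.tri) :=
  {T | ∃ S : OperadAlgebra (identities V).quotient.tri,
    OperadAlgebra.Isomorphic T (S.restrict (identities V).proj.tri)}

end Operad

/-! In characteristic 0 the variety generated by the algebras special with respect to any morphism
`ω : P → Q` consists exactly of the `P`-algebras on which `ker ω` acts as zero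
(`mem_specialVariety_iff`), and its multilinear identities are exactly `ker ω`
(`identities_specialVariety`). For `ω : N → M` this makes `tri-S^(ω)N` the class of `tri-N`-algebras
killed by the kernel of `id ⊗ proj`, where `proj` is the quotient of `N` by `ker ω`. The description
applied to `id ⊗ ω` gives the class killed by `ker (id ⊗ ω)`. Over a field the two kernels agree,
since tensoring with ComTrias respects inclusions of kernels. Nothing else about ComTrias is used.

The substantial point is that an algebra `B` killed by `ker ω` is a homomorphic image of a special
one (`exists_isSpecial_mapsOnto`). The test algebras are `ofBlocks Q Z`, which model the part of a
free algebra on `Z` where no generator repeats: an element is a family of operations on the nonempty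
subsets of `Z`, and a product sums over ways to split a subset into inputs. Take the product of
these over all finite sets `Fin (n + 1)` labelled by elements of `B`, and let the generic element of
`b` be the sum of all generators labelled `b`. The pairs (value of `ω p` at generic elements, value
of `p` in `B`) span a subalgebra of the product with `B`, which maps onto `B`. Its first projection
is injective: the coefficient multilinear in all generators is a sum of relabellings of `ω p` over
bijections compatible with the labels, so the value in `B` is recovered by averaging over `(n + 1)!`
bijections. -/

/-! ### Partitions of finite sets into labelled parts. -/

/-- The nonempty subsets of `Z`. -/
abbrev Block (Z : Type) : Type := {I : Set Z // I.Nonempty}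

instance Block.nonempty {Z : Type} (I : Block Z) : Nonempty I.1 := I.2.to_subtype

/-- The whole of `Z` as a nonempty subset. -/
def Block.univ (Z : Type) [Nonempty Z] : Block Z := ⟨Set.univ, Set.univ_nonempty⟩

/-- The whole of `Z`, as a subset, is in bijection with `Z`. -/
def Block.univEquiv (Z : Type) [Nonempty Z] : (Block.univ Z).1 ≃ Z := Equiv.Set.univ Z

/-- The family `D` partitions the set `I` into nonempty labelled parts. -/
structure IsDecomp {Z ι : Type} (D : ι → Block Z) (I : Block Z) : Prop where
  subset : ∀ i, (D i).1 ⊆ I.1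
  cover : ∀ z ∈ I.1, ∃ i, z ∈ (D i).1
  disjoint : ∀ {i j z}, z ∈ (D i).1 → z ∈ (D j).1 → i = j

namespace IsDecomp

variable {Z ι : Type} {D : ι → Block Z} {I : Block Z}

/-- The disjoint union of the parts of a partition of `I` is `I`. -/
noncomputable def equiv (h : IsDecomp D I) : (Σ i, (D i).1) ≃ I.1 :=
  Equiv.ofBijective (fun x => ⟨x.2.1, h.subset _ x.2.2⟩) <| by
    constructor
    · rintro ⟨i, z, hz⟩ ⟨j, w, hw⟩ hzw
      obtain rfl : z = w := congrArg Subtype.val hzw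
      obtain rfl := h.disjoint hz hw
      rfl
    · rintro ⟨z, hz⟩
      obtain ⟨i, hi⟩ := h.cover z hz
      exact ⟨⟨i, z, hi⟩, rfl⟩

theorem const (I : Block Z) : IsDecomp (fun _ : Unit => I) I :=
  ⟨fun _ => subset_rfl, fun _ hz => ⟨(), hz⟩, fun _ _ => rfl⟩

theorem eq_const {D : Unit → Block Z} (h : IsDecomp D I) : D = fun _ => I := by
  funext i
  apply Subtype.ext
  refine (h.subset i).antisymm fun z hz => ?_
  obtain ⟨j, hj⟩ := h.cover z hz
  exact hj

theorem comp_equiv {κ : Type} {D : κ → Block Z} (h : IsDecomp D I) (e : ι ≃ κ) :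
    IsDecomp (fun i => D (e i)) I :=
  ⟨fun i => h.subset _, fun z hz => by
    obtain ⟨j, hj⟩ := h.cover z hz
    exact ⟨e.symm j, by simpa using hj⟩, fun h1 h2 => e.injective (h.disjoint h1 h2)⟩

theorem sigma {κ : ι → Type} {F : ∀ i, κ i → Block Z} (h : IsDecomp D I)
    (hF : ∀ i, IsDecomp (F i) (D i)) : IsDecomp (fun x : Σ i, κ i => F x.1 x.2) I where
  subset x := ((hF x.1).subset x.2).trans (h.subset x.1)
  cover z hz := by
    obtain ⟨i, hi⟩ := h.cover z hz
    obtain ⟨j, hj⟩ := (hF i).cover z hi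
    exact ⟨⟨i, j⟩, hj⟩
  disjoint {x y z} h1 h2 := by
    obtain ⟨i, j⟩ := x
    obtain ⟨i', j'⟩ := y
    obtain rfl := h.disjoint ((hF i).subset j h1) ((hF i').subset j' h2)
    obtain rfl := (hF i).disjoint h1 h2
    rfl

end IsDecomp

/-- The union of a nonempty family of nonempty sets. -/
def Block.iUnion {Z κ : Type} [Nonempty κ] (D : κ → Block Z) : Block Z :=
  ⟨⋃ j, (D j).1, Set.nonempty_iUnion.2 ⟨Classical.arbitrary κ, (D _).2⟩⟩

theorem IsDecomp.iUnion_eq {Z κ : Type} [Nonempty κ] {D : κ → Block Z} {I : Block Z}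
    (h : IsDecomp D I) : Block.iUnion D = I := by
  apply Subtype.ext
  ext z
  simp only [Block.iUnion, Set.mem_iUnion]
  exact ⟨fun ⟨j, hj⟩ => h.subset j hj, h.cover z⟩

/-- The partitions of `I` into parts labelled by `ι`. -/
abbrev Decomp {Z : Type} (ι : Type) (I : Block Z) : Type := {D : ι → Block Z // IsDecomp D I}

namespace Decomp

variable {Z ι κ : Type}

noncomputable instance [Finite ι] [Finite Z] (I : Block Z) : Fintype (Decomp ι I) :=
  Fintype.ofFinite _

noncomputable instance (I : Block Z) : Unique (Decomp Unit I) where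
  default := ⟨fun _ => I, .const I⟩
  uniq D := Subtype.ext D.2.eq_const

/-- Relabelling of partitions. -/
def congr (e : ι ≃ κ) (I : Block Z) : Decomp κ I ≃ Decomp ι I where
  toFun D := ⟨fun i => D.1 (e i), D.2.comp_equiv e⟩
  invFun D := ⟨fun i => D.1 (e.symm i), D.2.comp_equiv e.symm⟩
  left_inv D := by simp
  right_inv D := by simp

/-- A two-step partition is a partition into parts with double labels. -/
def sigmaEquiv {κ : ι → Type} [∀ i, Nonempty (κ i)] (I : Block Z) :
    (Σ E : Decomp ι I, ∀ i, Decomp (κ i) (E.1 i)) ≃ Decomp (Σ i, κ i) I where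
  toFun F := ⟨fun x => (F.2 x.1).1 x.2, F.1.2.sigma fun i => (F.2 i).2⟩
  invFun D :=
    ⟨⟨fun i => Block.iUnion fun j => D.1 ⟨i, j⟩,
      { subset := fun i => Set.iUnion_subset fun j => D.2.subset _
        cover := fun z hz => by
          obtain ⟨x, hx⟩ := D.2.cover z hz
          exact ⟨x.1, Set.mem_iUnion.2 ⟨x.2, hx⟩⟩
        disjoint := fun h1 h2 => by
          obtain ⟨j, hj⟩ := Set.mem_iUnion.1 h1
          obtain ⟨j', hj'⟩ := Set.mem_iUnion.1 h2
          exact congrArg Sigma.fst (D.2.disjoint hj hj') }⟩,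
      fun i => ⟨fun j => D.1 ⟨i, j⟩,
        { subset := fun j => Set.subset_iUnion (fun j => (D.1 ⟨i, j⟩).1) j
          cover := fun z hz => Set.mem_iUnion.1 hz
          disjoint := fun h1 h2 => by simpa using D.2.disjoint h1 h2 }⟩⟩
  left_inv := by
    rintro ⟨⟨E, hE⟩, F⟩
    -- The outer parts are forced to be the unions of the inner ones. Once the inner families are
    -- split from their proofs, `E` can be replaced by these unions and the round trip is
    -- definitional.
    obtain ⟨G, hG, rfl⟩ : ∃ (G : ∀ i, κ i → Block Z) (hG : ∀ i, IsDecomp (G i) (E i)),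
        F = fun i => ⟨G i, hG i⟩ := ⟨fun i => (F i).1, fun i => (F i).2, rfl⟩
    obtain rfl : (fun i => Block.iUnion (G i)) = E := funext fun i => (hG i).iUnion_eq
    rfl
  right_inv D := rfl

end Decomp

/-! ### The algebra of block families and its multilinear top component. -/

namespace OperadAlgebra

variable {k : Type u} [Field k]

section Blocks

variable (M : Operad k) (Z : Type)

/-- Families of operations `a_I ∈ M(I)`, where `I` runs over the nonempty subsets of `Z`. -/
abbrev BlockFamily [Finite Z] : Type u := ∀ I : Block Z, M.obj I.1

variable [Finite Z] {ι : Type} [Finite ι] [Nonempty ι]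

/-- The product of families of operations, which sums over all ways to partition `I`. -/
noncomputable def blockAct :
    M.obj ι →ₗ[k] MultilinearMap k (fun _ : ι => BlockFamily M Z) (BlockFamily M Z) where
  -- The inputs of the composite form the disjoint union of the parts of `D`, which is relabelled to
  -- `I`.
  toFun p := MultilinearMap.pi fun I => ∑ D : Decomp ι I,
    (M.map D.2.equiv).compMultilinearMap
      ((M.comp p).compLinearMap fun i => LinearMap.proj (D.1 i))
  map_add' p q := by ext; simp [Finset.sum_add_distrib]
  map_smul' c p := by ext; simp [Finset.smul_sum]

variable {M Z}

theorem blockAct_apply (p : M.obj ι) (v : ι → BlockFamily M Z) (I : Block Z) :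
    blockAct M Z p v I =
      ∑ D : Decomp ι I, M.map D.2.equiv (M.comp p fun i => v i (D.1 i)) := by
  simp [blockAct]

end Blocks

/-- The algebra of families of operations indexed by the nonempty subsets of `Z`. -/
noncomputable def ofBlocks (M : Operad k) (Z : Type) [Finite Z] : OperadAlgebra M where
  carrier := BlockFamily M Z
  act := blockAct M Z
  act_map {ι κ} _ _ _ _ e p v := by
    ext I
    simp only [blockAct_apply]
    refine Fintype.sum_equiv (Decomp.congr e I) _ _ fun D => ?_
    -- All the relabellings merely forget which part a point lies in, so they agree pointwise.
    have he : (Equiv.sigmaCongrLeft (β := fun j => (D.1 j).1) e).trans D.2.equiv =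
        (D.2.comp_equiv e).equiv := Equiv.ext fun _ => rfl
    rw [M.map_comp, ← M.map_trans, he]
    rfl
  act_one v := by
    ext I
    simp only [blockAct_apply]
    rw [Fintype.sum_unique]
    have he : (IsDecomp.const I).equiv = Equiv.uniqueSigma fun _ : Unit => I.1 :=
      Equiv.ext fun _ => rfl
    have h := M.one_comp (v () I)
    rw [← he] at h
    exact h
  act_comp {ι} _ _ {κ} _ _ p q v := by
    ext I
    simp only [blockAct_apply]
    have := Fintype.ofFinite ι
    classical
    -- Partitions with double labels are two-step partitions; multilinearity of the outer
    -- composition then pulls out the inner sums, and the terms match by associativity.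
    rw [← (Decomp.sigmaEquiv (κ := κ) I).sum_comp, Fintype.sum_sigma]
    refine Finset.sum_congr rfl fun E _ => ?_
    rw [MultilinearMap.map_sum, map_sum]
    refine Finset.sum_congr rfl fun F _ => ?_
    have he : ((Equiv.sigmaAssoc fun i j => ((F i).1 j).1).trans
        ((Equiv.sigmaCongrRight fun i => (F i).2.equiv).trans E.2.equiv)) =
          (E.2.sigma fun i => (F i).2).equiv := Equiv.ext fun _ => rfl
    rw [M.comp_map, ← M.comp_assoc, ← M.map_trans, ← M.map_trans, he]
    rfl

/-- The family with the identity operation at `{z}` and zero elsewhere. -/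
noncomputable def point (M : Operad k) {Z : Type} [Finite Z] (z : Z) : BlockFamily M Z :=
  open Classical in fun I =>
    if h : I = ⟨{z}, Set.singleton_nonempty z⟩ then
      -- `I` is only propositionally equal to `{z}`, hence the transport along `h`.
      M.map ((Equiv.ofUnique Unit ({z} : Set Z)).trans (Equiv.setCongr (congrArg Subtype.val h.symm)))
        M.one
    else 0

/-- The component of a family at the whole set. -/
noncomputable def top (M : Operad k) (Z : Type) [Finite Z] [Nonempty Z] :
    BlockFamily M Z →ₗ[k] M.obj Z :=
  M.map (Block.univEquiv Z) ∘ₗ LinearMap.proj (R := k) (φ := fun I : Block Z => M.obj I.1) (Block.univ Z)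

variable {M : Operad k} {Z ι : Type} [Finite Z] [Nonempty Z] [Finite ι] [Nonempty ι]

theorem top_act (p : M.obj ι) (v : ι → BlockFamily M Z) :
    top M Z (blockAct M Z p v) = ∑ D : Decomp ι (Block.univ Z),
      M.map (D.2.equiv.trans (Block.univEquiv Z)) (M.comp p fun i => v i (D.1 i)) := by
  simp [top, blockAct_apply, M.map_trans]

omit [Nonempty Z] in
theorem comp_point_eq_zero (p : M.obj ι) (σ : ι → Z) (D : ι → Block Z)
    (h : D ≠ fun i => ⟨{σ i}, Set.singleton_nonempty _⟩) :
    M.comp p (fun i => point M (σ i) (D i)) = 0 := by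
  obtain ⟨i, hi⟩ := Function.ne_iff.1 h
  exact (M.comp p).map_coord_zero i (dif_neg hi)

theorem top_act_point_equiv (p : M.obj ι) (σ : ι ≃ Z) :
    top M Z (blockAct M Z p fun i => point M (σ i)) = M.map σ p := by
  have h0 : IsDecomp (fun i => (⟨{σ i}, Set.singleton_nonempty _⟩ : Block Z)) (Block.univ Z) :=
    ⟨fun i => Set.subset_univ _, fun z _ => ⟨σ.symm z, by simp⟩,
      fun h1 h2 => σ.injective ((Set.mem_singleton_iff.1 h1).symm.trans h2)⟩
  -- Points are supported on singletons, so only the partition into singletons contributes; its term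
  -- is `p` composed with identity operations.
  rw [top_act, Fintype.sum_eq_single ⟨_, h0⟩]
  · have h1 : ∀ i, point M (σ i) ⟨{σ i}, Set.singleton_nonempty _⟩ =
        M.map (Equiv.ofUnique Unit ({σ i} : Set Z)) M.one := fun i => dif_pos rfl
    simp only [h1]
    rw [M.comp_map, ← M.map_trans]
    conv_rhs => rw [← M.comp_one p, ← M.map_trans]
    congr 2
    ext ⟨i, u⟩
    rfl
  · intro D hD
    rw [comp_point_eq_zero p σ D.1 fun h => hD (Subtype.ext h), map_zero]

/-- A nonzero term needs the parts to be the singletons `{σ i}`, and these form a labelled partition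
of `Z` only if `σ` is bijective. -/
theorem top_act_point_eq_zero (p : M.obj ι) (σ : ι → Z) (hσ : ¬ Function.Bijective σ) :
    top M Z (blockAct M Z p fun i => point M (σ i)) = 0 := by
  rw [top_act]
  refine Finset.sum_eq_zero fun D _ => ?_
  rw [comp_point_eq_zero p σ D.1, map_zero]
  refine fun h => hσ ⟨fun i j hij => D.2.disjoint (z := σ i) ?_ ?_, fun z => ?_⟩
  · rw [h]; rfl
  · rw [h]; exact hij
  · obtain ⟨i, hi⟩ := D.2.cover z trivial
    rw [h] at hi
    exact ⟨i, hi.symm⟩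

/-- An operation that vanishes on the algebra of families indexed by its inputs is zero. -/
theorem eq_zero_of_blockAct (p : M.obj ι) (h : ∀ v, blockAct M ι p v = 0) : p = 0 := by
  -- Evaluated at the points themselves, the top component returns the operation `p`.
  rw [← M.map_refl p, ← top_act_point_equiv p (Equiv.refl ι), h, map_zero]

open Classical in
/-- The sum of all points with a given label. -/
noncomputable def labelSum (M : Operad k) [Fintype Z] {X : Type u} (l : Z → X) (x : X) :
    BlockFamily M Z :=
  ∑ z : Z, if l z = x then point M z else 0

-- The label sums expand into a sum over all maps from `ι` to `Z` compatible with the labels. Only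
-- bijections survive, so the top component symmetrises `p` over label-preserving bijections.
open Classical in
theorem top_act_labelSum [Fintype Z] {X : Type u} (l : Z → X) (b : ι → X) (p : M.obj ι)
    [Fintype (ι ≃ Z)] :
    top M Z (blockAct M Z p fun i => labelSum M l (b i)) =
      ∑ σ : ι ≃ Z, if l ∘ σ = b then M.map σ p else 0 := by
  have := Fintype.ofFinite ι
  simp only [labelSum]
  rw [MultilinearMap.map_sum, map_sum]
  symm
  refine Finset.sum_of_injOn (fun σ i => σ i) (DFunLike.coe_injective.injOn) (by simp) ?_ ?_
  · intro σ _ hσ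
    by_cases h : ∀ i, l (σ i) = b i
    · simp only [h, if_true]
      refine top_act_point_eq_zero p σ fun hb => hσ ⟨Equiv.ofBijective σ hb, by simp, rfl⟩
    · obtain ⟨i, hi⟩ := not_forall.1 h
      rw [(blockAct M Z p).map_coord_zero i (if_neg hi), map_zero]
  · intro σ _
    split_ifs with h
    · have h' : ∀ i, l (σ i) = b i := congrFun h
      simp only [h', if_true]
      exact (top_act_point_equiv p σ).symm
    · obtain ⟨i, hi⟩ := Function.ne_iff.1 h
      rw [(blockAct M Z p).map_coord_zero i (if_neg hi), map_zero]

end OperadAlgebra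

/-! ### Linear algebra: spans and factorisation through kernels. -/

/-- A multilinear map that sends families of elements of `s` into a submodule also sends families
of elements of the span of `s` into it. -/
theorem MultilinearMap.mem_of_forall_mem_span {k ι E F : Type*} [Finite ι] [Field k]
    [AddCommGroup E] [Module k E] [AddCommGroup F] [Module k F]
    (f : MultilinearMap k (fun _ : ι => E) F) {s : Set E} {T : Submodule k F}
    (h : ∀ v, (∀ i, v i ∈ s) → f v ∈ T) (v : ι → E) (hv : ∀ i, v i ∈ Submodule.span k s) :
    f v ∈ T := by
  classical
  have := Fintype.ofFinite ι
  -- Induction on the set `u` of coordinates known only to lie in the span; the others already lie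
  -- in `s`.
  have key : ∀ (u : Finset ι) (v : ι → E), (∀ i ∈ u, v i ∈ Submodule.span k s) →
      (∀ i ∉ u, v i ∈ s) → f v ∈ T := by
    intro u
    induction u using Finset.induction_on with
    | empty => exact fun v _ h2 => h v fun i => h2 i (Finset.notMem_empty i)
    | insert a u ha ih =>
      intro v h1 h2
      have h3 : ∀ x ∈ Submodule.span k s, f (Function.update v a x) ∈ T := by
        intro x hx
        induction hx using Submodule.span_induction with
        | mem x hx =>
          refine ih _ (fun i hi => ?_) fun i hi => ?_
          · rw [Function.update_of_ne (ne_of_mem_of_not_mem hi ha)]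
            exact h1 i (Finset.mem_insert_of_mem hi)
          · by_cases hia : i = a
            · subst hia
              rwa [Function.update_self]
            · rw [Function.update_of_ne hia]
              exact h2 i (by simp [hia, hi])
        | zero => rw [f.map_update_zero]; exact T.zero_mem
        | add x y _ _ hx hy => rw [f.map_update_add]; exact T.add_mem hx hy
        | smul c x _ hx => rw [f.map_update_smul]; exact T.smul_mem c hx
      simpa using h3 (v a) (h1 a (Finset.mem_insert_self a u))
  exact key Finset.univ v (fun i _ => hv i) fun i hi => absurd (Finset.mem_univ i) hi

/-- Over a field, a linear map that vanishes on the kernel of another one factors through it. -/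
theorem LinearMap.exists_comp_eq_of_ker_le {k E F G : Type*} [Field k] [AddCommGroup E]
    [Module k E] [AddCommGroup F] [Module k F] [AddCommGroup G] [Module k G] (f : E →ₗ[k] F)
    (g : E →ₗ[k] G) (h : LinearMap.ker f ≤ LinearMap.ker g) : ∃ r : F →ₗ[k] G, r ∘ₗ f = g := by
  -- The injection of the quotient by `ker f` into `F` splits, which extends the induced map from
  -- the range of `f` to all of `F`.
  obtain ⟨l, hl⟩ := ((LinearMap.ker f).liftQ f le_rfl).exists_leftInverse_of_injective
    (Submodule.ker_liftQ_eq_bot' _ _ rfl)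
  refine ⟨(LinearMap.ker f).liftQ g h ∘ₗ l, LinearMap.ext fun x => ?_⟩
  have := LinearMap.congr_fun hl ((LinearMap.ker f).mkQ x)
  simp only [LinearMap.comp_apply, Submodule.mkQ_apply, Submodule.liftQ_apply,
    LinearMap.id_apply] at this
  simp [this]

/-! ### Algebras killed by the kernel of a morphism. -/

namespace OperadAlgebra

variable {k : Type u} [Field k] {P Q : Operad k}

/-- A subspace closed under all operations is an algebra. -/
def ofSubmodule (A : OperadAlgebra P) (S : Submodule k A.carrier)
    (hS : ∀ {ι : Type} [Finite ι] [Nonempty ι] (p : P.obj ι) (v : ι → A.carrier),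
      (∀ i, v i ∈ S) → A.act p v ∈ S) : OperadAlgebra P where
  carrier := S
  act {ι} _ _ :=
    { toFun := fun p => ((A.act p).compLinearMap fun _ => S.subtype).codRestrict S fun v =>
        hS p _ fun i => (v i).2
      map_add' := fun p q => by
        ext v
        change A.act (p + q) _ = A.act p _ + A.act q _
        rw [map_add, _root_.add_apply]
      map_smul' := fun c p => by
        ext v
        change A.act (c • p) _ = c • A.act p _
        rw [map_smul, _root_.smul_apply] }
  act_map e p v := Subtype.ext (A.act_map e p _)
  act_one v := Subtype.ext (A.act_one _)
  act_comp p q v := Subtype.ext (A.act_comp p q _)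

/-- The product of two algebras. -/
def prod (A B : OperadAlgebra P) : OperadAlgebra P where
  carrier := A.carrier × B.carrier
  act {ι} _ _ :=
    { toFun := fun p => ((A.act p).compLinearMap fun _ => LinearMap.fst k _ _).prod
        ((B.act p).compLinearMap fun _ => LinearMap.snd k _ _)
      map_add' := fun p q => by ext <;> simp
      map_smul' := fun c p => by ext <;> simp }
  act_map e p v := by simp [act_map]
  act_one v := by simp [act_one]
  act_comp p q v := by simp [act_comp]

/-- The first projection of a product of two algebras. -/
def fst (A B : OperadAlgebra P) : (A.prod B).carrier →ₗ[k] A.carrier :=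
  LinearMap.fst k A.carrier B.carrier

/-- The second projection of a product of two algebras. -/
def snd (A B : OperadAlgebra P) : (A.prod B).carrier →ₗ[k] B.carrier :=
  LinearMap.snd k A.carrier B.carrier

/-- The class of algebras on which the kernel of a morphism acts as zero is a variety. -/
theorem isVariety_ker (ω : Operad.Hom P Q) :
    IsVariety {A : OperadAlgebra P | ∀ (ι : Type) [Finite ι] [Nonempty ι] (p : P.obj ι),
      ω.app p = 0 → A.act p = 0} where
  sub := by
    rintro A B ⟨f, hf, hinj⟩ hB ι _ _ p hp
    ext v
    apply hinj
    rw [hf p v, hB ι p hp, _root_.zero_apply, _root_.zero_apply, map_zero]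
  quot := by
    rintro A B ⟨f, hf, hsurj⟩ hA ι _ _ p hp
    ext v
    choose w hw using fun i => hsurj (v i)
    obtain rfl : (fun i => f (w i)) = v := funext hw
    rw [← hf p w, hA ι p hp, _root_.zero_apply, _root_.zero_apply, map_zero]
  prod J A hA ι _ _ p hp := by
    ext v
    funext j
    change (A j).act p _ = 0
    rw [hA j ι p hp, _root_.zero_apply]

/-- The class killed by `ker ω` is a variety containing every special algebra. This direction holds
in any characteristic. -/
theorem act_eq_zero_of_mem_specialVariety (ω : Operad.Hom P Q) {A : OperadAlgebra P}
    (hA : A ∈ specialVariety ω) {ι : Type} [Finite ι] [Nonempty ι] (p : P.obj ι)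
    (hp : ω.app p = 0) : A.act p = 0 := by
  refine hA _ (isVariety_ker ω) ?_ ι p hp
  rintro B ⟨C, f, hf, hinj⟩ ι _ _ p hp
  ext v
  apply hinj
  rw [hf p v, _root_.zero_apply, map_zero]
  change C.act (ω.app p) _ = 0
  rw [hp, map_zero]
  rfl

/-- The restricted block algebra on the inputs of `p` is special and detects whether `ω p` vanishes,
again in any characteristic. -/
theorem identities_specialVariety (ω : Operad.Hom P Q) (ι : Type) [Finite ι] [Nonempty ι] :
    (Operad.identities (specialVariety ω)).carrier ι = LinearMap.ker ω.app := by
  ext p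
  refine ⟨fun hp => eq_zero_of_blockAct _ fun v => ?_, fun hp A hA v => ?_⟩
  · exact hp ((ofBlocks Q ι).restrict ω)
      (fun V _ hV => hV ⟨ofBlocks Q ι, LinearMap.id, fun _ _ => rfl, fun _ _ h => h⟩) v
  · rw [act_eq_zero_of_mem_specialVariety ω hA p hp, _root_.zero_apply]

/-! ### Generic elements: presenting an algebra as an image of a special one. -/

section Generic

variable (ω : Operad.Hom P Q) (B : OperadAlgebra P)

/-- A `Q`-algebra with generic elements labelled by the elements of `B`. -/
noncomputable def genericAlgebra : OperadAlgebra Q :=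
  -- The sets have `n + 1` elements because operations have at least one input.
  pi fun t : Σ n : ℕ, Fin (n + 1) → B.carrier => ofBlocks Q (Fin (t.1 + 1))

/-- The generic element with label `b`. -/
noncomputable def generic (b : B.carrier) : (genericAlgebra (Q := Q) B).carrier :=
  fun t => labelSum Q t.2 b

/-- The relation between generic elements and their values, spanned by pairs of monomials. -/
noncomputable def genericRelation :
    Submodule k (((genericAlgebra B).restrict ω).prod B).carrier :=
  Submodule.span k {x | ∃ (ι : Type) (_ : Finite ι) (_ : Nonempty ι) (p : P.obj ι)
    (b : ι → B.carrier),
      x = ((genericAlgebra B).act (ω.app p) fun i => generic B (b i), B.act p b)}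

/-- By multilinearity it suffices to act on spanning pairs, and an operation applied to such pairs
is the spanning pair of the composite operation. -/
theorem act_mem_genericRelation {ι : Type} [Finite ι] [Nonempty ι] (p : P.obj ι)
    (v : ι → (((genericAlgebra B).restrict ω).prod B).carrier)
    (hv : ∀ i, v i ∈ genericRelation ω B) :
    (((genericAlgebra B).restrict ω).prod B).act p v ∈ genericRelation ω B := by
  refine MultilinearMap.mem_of_forall_mem_span _ (fun v hv => ?_) v hv
  choose κ h1 h2 q b h using hv
  refine Submodule.subset_span ⟨Σ i, κ i, inferInstance, inferInstance, P.comp p q,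
    fun x => b x.1 x.2, ?_⟩
  rw [ω.app_comp, act_comp, act_comp]
  obtain rfl := funext h
  rfl

/-- The top component of the factor with index `t` of an element of the generic algebra. -/
noncomputable def genericTop (t : Σ n : ℕ, Fin (n + 1) → B.carrier) :
    ((genericAlgebra B).restrict ω).carrier →ₗ[k] Q.obj (Fin (t.1 + 1)) :=
  top Q (Fin (t.1 + 1)) ∘ₗ LinearMap.proj (R := k)
    (φ := fun t : Σ n : ℕ, Fin (n + 1) → B.carrier => BlockFamily Q (Fin (t.1 + 1))) t

/-- A relation between generic elements and their values determines the value: in characteristic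
zero it is an average of top components. -/
theorem eventually_eq_sum [CharZero k]
    (ε : ∀ t : Σ n : ℕ, Fin (n + 1) → B.carrier, Q.obj (Fin (t.1 + 1)) →ₗ[k] B.carrier)
    (hε : ∀ t p, ε t (ω.app p) = B.act p t.2)
    (x : (((genericAlgebra B).restrict ω).prod B).carrier) (hx : x ∈ genericRelation ω B) :
    ∀ᶠ T : Finset (Σ n : ℕ, Fin (n + 1) → B.carrier) in Filter.atTop,
      snd _ _ x = ∑ t ∈ T,
        ((t.1 + 1).factorial : k)⁻¹ • ε t (genericTop ω B t (fst _ _ x)) := by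
  classical
  -- Only finitely many indices matter for each spanning pair, but which ones depends on the pair.
  -- Asking for equality for all large `T` makes the claim stable under sums.
  induction hx using Submodule.span_induction with
  | zero => simp
  | add x y _ _ hx hy =>
    filter_upwards [hx, hy] with T hx hy
    simp only [map_add, smul_add, Finset.sum_add_distrib, hx, hy]
  | smul c x _ hx =>
    filter_upwards [hx] with T hx
    simp only [map_smul, hx, Finset.smul_sum]
    exact Finset.sum_congr rfl fun t _ => smul_comm _ _ _
  | mem x hx =>
    obtain ⟨ι, _, _, p, b, rfl⟩ := hx
    have := Fintype.ofFinite ι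
    obtain ⟨m, hm⟩ := Nat.exists_eq_succ_of_ne_zero (Fintype.card_ne_zero (α := ι))
    have e0 : ι ≃ Fin (m + 1) := Fintype.equivFinOfCardEq hm
    -- The only labellings that contribute are those obtained by carrying `b` along a bijection; `T`
    -- must contain them all.
    filter_upwards [Filter.eventually_ge_atTop (Finset.univ.image fun σ : ι ≃ Fin (m + 1) =>
      (⟨m, b ∘ σ.symm⟩ : Σ n : ℕ, Fin (n + 1) → B.carrier))] with T hT
    -- Each term becomes a sum over the same set of bijections, even when `t` has the wrong size, so
    -- that the two sums can be exchanged.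
    have hterm : ∀ t : Σ n : ℕ, Fin (n + 1) → B.carrier,
        ((t.1 + 1).factorial : k)⁻¹ • ε t (genericTop ω B t ((genericAlgebra B).act (ω.app p)
          fun i => generic B (b i))) = ∑ σ : ι ≃ Fin (m + 1),
            if t = ⟨m, b ∘ σ.symm⟩ then ((m + 1).factorial : k)⁻¹ • B.act p b else 0 := by
      rintro ⟨n, l⟩
      have h1 := top_act_labelSum l b (ω.app p)
      change _ • ε ⟨n, l⟩ (top Q (Fin (n + 1))
        (blockAct Q (Fin (n + 1)) (ω.app p) fun i => labelSum Q l (b i))) = _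
      rw [h1]
      by_cases hn : n = m
      · subst hn
        rw [map_sum, Finset.smul_sum]
        refine Finset.sum_congr rfl fun σ _ => ?_
        have h2 : l ∘ σ = b ↔ (⟨n, l⟩ : Σ n : ℕ, Fin (n + 1) → B.carrier) = ⟨n, b ∘ σ.symm⟩ := by
          rw [Sigma.mk.injEq, heq_eq_eq, Equiv.eq_comp_symm]
          simp
        by_cases h : l ∘ σ = b
        · rw [if_pos h, if_pos (h2.1 h), ← ω.app_map, hε, act_map]
          subst h
          rfl
        · rw [if_neg h, if_neg (mt h2.2 h), map_zero, smul_zero]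
      · have : IsEmpty (ι ≃ Fin (n + 1)) := ⟨fun e => hn <| by
          have := Fintype.card_congr (e.symm.trans e0)
          simpa using this⟩
        rw [Finset.univ_eq_empty, Finset.sum_empty, map_zero, smul_zero]
        symm
        exact Finset.sum_eq_zero fun σ _ => if_neg fun h => hn (congrArg Sigma.fst h)
    change B.act p b = ∑ t ∈ T, _ • ε t (genericTop ω B t ((genericAlgebra B).act (ω.app p)
      fun i => generic B (b i)))
    simp only [hterm]
    -- Each `σ` selects exactly one index `t`, so `B.act p b` is counted once for each of the `(m +
    -- 1)!` bijections, which cancels the factor.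
    rw [Finset.sum_comm]
    have h3 : ∀ σ : ι ≃ Fin (m + 1), (⟨m, b ∘ σ.symm⟩ : Σ n : ℕ, Fin (n + 1) → B.carrier) ∈ T :=
      fun σ => hT (Finset.mem_image_of_mem _ (Finset.mem_univ σ))
    simp only [Finset.sum_ite_eq', h3, if_true, Finset.sum_const, Finset.card_univ]
    rw [Fintype.card_equiv e0, hm, ← Nat.cast_smul_eq_nsmul k, smul_smul,
      mul_inv_cancel₀ (Nat.cast_ne_zero.2 (Nat.factorial_ne_zero _)), one_smul]

/-- In characteristic zero, an algebra on which the kernel of `ω` acts as zero is a homomorphic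
image of an algebra that is special with respect to `ω`. -/
theorem exists_isSpecial_mapsOnto [CharZero k]
    (hB : ∀ (ι : Type) [Finite ι] [Nonempty ι] (p : P.obj ι), ω.app p = 0 → B.act p = 0) :
    ∃ R : OperadAlgebra P, IsSpecial ω R ∧ MapsOnto R B := by
  have h0 : ∀ t : Σ n : ℕ, Fin (n + 1) → B.carrier,
      -- Evaluation of `p` at the labels depends only on `ω p`, since `ker ω` acts as zero; it is
      -- then extended linearly off the image of `ω`.
      ∃ r : Q.obj (Fin (t.1 + 1)) →ₗ[k] B.carrier,
        r ∘ₗ ω.app = Operad.evalMultilinear t.2 ∘ₗ B.act := fun t =>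
    ω.app.exists_comp_eq_of_ker_le _ fun p hp => by
      rw [LinearMap.mem_ker, LinearMap.comp_apply, hB _ p hp, map_zero]
  choose ε hε using h0
  refine ⟨ofSubmodule _ (genericRelation ω B) fun p v hv => act_mem_genericRelation ω B p v hv,
    ⟨genericAlgebra B, fst _ _ ∘ₗ Submodule.subtype _, fun p v => rfl, ?_⟩,
    snd _ _ ∘ₗ Submodule.subtype _, fun p v => rfl, fun b => ?_⟩
  -- If the first component vanishes, the averaging formula gives zero for the second, so projection
  -- to the generic algebra is injective.
  · rw [← LinearMap.ker_eq_bot, LinearMap.ker_eq_bot']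
    rintro ⟨x, hx⟩ (h : fst _ _ x = 0)
    obtain ⟨T, hT⟩ :=
      (eventually_eq_sum ω B ε (fun t p => LinearMap.congr_fun (hε t) p) x hx).exists
    refine Subtype.ext (Prod.ext h (hT.trans (Finset.sum_eq_zero fun t _ => ?_)))
    rw [h, map_zero, map_zero, smul_zero]
  -- The identity operation at the label `b` gives a spanning pair with value `b`.
  · exact ⟨⟨_, Submodule.subset_span ⟨Unit, inferInstance, inferInstance, P.one, fun _ => b, rfl⟩⟩,
      B.act_one _⟩

/-- One homomorphic image of one special algebra already reaches every algebra killed by `ker ω`. -/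
theorem mem_specialVariety_iff [CharZero k] : B ∈ specialVariety ω ↔
    ∀ (ι : Type) [Finite ι] [Nonempty ι] (p : P.obj ι), ω.app p = 0 → B.act p = 0 := by
  refine ⟨fun h ι _ _ p hp => act_eq_zero_of_mem_specialVariety ω h p hp, fun h V hV hVs => ?_⟩
  obtain ⟨R, hR, hRB⟩ := exists_isSpecial_mapsOnto ω B h
  exact hV.quot R B hRB (hVs hR)

end Generic

/-! ### Algebras over quotient operads, and the comparison of kernels after tensoring. -/

/-- Algebras over the target of a surjective morphism are the algebras on which its kernel acts
as zero. -/
theorem exists_isomorphic_restrict_iff (π : Operad.Hom P Q)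
    (hπ : ∀ (ι : Type) [Finite ι] [Nonempty ι], Function.Surjective (π.app (ι := ι)))
    (T : OperadAlgebra P) :
    (∃ S : OperadAlgebra Q, Isomorphic T (S.restrict π)) ↔
      ∀ (ι : Type) [Finite ι] [Nonempty ι] (p : P.obj ι), π.app p = 0 → T.act p = 0 := by
  constructor
  · rintro ⟨S, f, hf, hbij⟩ ι _ _ p hp
    ext v
    apply hbij.1
    rw [hf p v, _root_.zero_apply, map_zero]
    change S.act (π.app p) _ = 0
    rw [hp, map_zero]
    rfl
  · intro h
    have h0 : ∀ (ι : Type) [Finite ι] [Nonempty ι],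
        ∃ r : Q.obj ι →ₗ[k] MultilinearMap k (fun _ : ι => T.carrier) T.carrier,
          r ∘ₗ π.app = T.act := fun ι _ _ =>
      π.app.exists_comp_eq_of_ker_le _ fun p hp => h ι p hp
    -- Surjectivity of `π` lets every algebra axiom for `r` be checked on images of operations of
    -- `P`, where it is an axiom of `T`.
    choose r hr using h0
    have hr' : ∀ (ι : Type) [Finite ι] [Nonempty ι] (p : P.obj ι), r ι (π.app p) = T.act p :=
      fun ι _ _ p => LinearMap.congr_fun (hr ι) p
    refine ⟨{ carrier := T.carrier, act := fun {ι} _ _ => r ι, act_map := ?_, act_one := ?_,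
              act_comp := ?_ }, LinearMap.id, ?_, Function.bijective_id⟩
    · intro ι κ _ _ _ _ e p v
      obtain ⟨p, rfl⟩ := hπ ι p
      rw [← π.app_map, hr', hr', T.act_map]
    · intro v
      rw [← π.app_one, hr', T.act_one]
    · intro ι _ _ κ _ _ p q v
      obtain ⟨p, rfl⟩ := hπ ι p
      choose q' hq using fun i => hπ (κ i) (q i)
      obtain rfl := funext hq
      rw [← π.app_comp]
      simp only [hr', T.act_comp]
    · intro ι _ _ p v
      exact congrArg (fun f => f v) (hr' ι p).symm

end OperadAlgebra

/-- Over a field, tensoring preserves inclusions between the kernels of linear maps. -/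
theorem LinearMap.lTensor_apply_eq_zero_of_ker_le {k C E F G : Type*} [Field k] [AddCommGroup C]
    [Module k C] [AddCommGroup E] [Module k E] [AddCommGroup F] [Module k F] [AddCommGroup G]
    [Module k G] (f : E →ₗ[k] F) (g : E →ₗ[k] G) (h : LinearMap.ker f ≤ LinearMap.ker g)
    (x : C ⊗[k] E) (hx : f.lTensor C x = 0) : g.lTensor C x = 0 := by
  obtain ⟨r, rfl⟩ := f.exists_comp_eq_of_ker_le g h
  rw [LinearMap.lTensor_comp, LinearMap.comp_apply, hx, map_zero]

theorem mainTheorem7 (k : Type u) [Field k] [CharZero k] (N M : Operad k) (ω : Operad.Hom N M) :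
    OperadAlgebra.specialVariety ω.tri =
      Operad.triVariety (OperadAlgebra.specialVariety ω) := by
  set I := Operad.identities (OperadAlgebra.specialVariety ω) with hI
  have hker : ∀ (ι : Type) [Finite ι] [Nonempty ι],
      LinearMap.ker (I.proj.app (ι := ι)) = LinearMap.ker (ω.app (ι := ι)) := fun ι _ _ =>
    (Submodule.ker_mkQ _).trans (OperadAlgebra.identities_specialVariety ω ι)
  have hsurj : ∀ (ι : Type) [Finite ι] [Nonempty ι],
      Function.Surjective (I.proj.tri.app (ι := ι)) := fun ι _ _ =>
    -- The components of `id ⊗ proj` are by definition the quotient maps tensored on the left with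
    -- ComTrias.
    LinearMap.lTensor_surjective _ (Submodule.mkQ_surjective _)
  ext T
  refine (OperadAlgebra.mem_specialVariety_iff ω.tri T).trans
    (Iff.trans ?_ (OperadAlgebra.exists_isomorphic_restrict_iff I.proj.tri hsurj T).symm)
  -- Both classes are now given by vanishing on a kernel, so it remains to compare the kernels of
  -- `id ⊗ ω` and `id ⊗ proj`.
  refine forall_congr' fun ι => forall_congr' fun _ => forall_congr' fun _ =>
    forall_congr' fun p => imp_congr_left ?_
  exact ⟨LinearMap.lTensor_apply_eq_zero_of_ker_le _ _ (hker ι).ge p,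
    LinearMap.lTensor_apply_eq_zero_of_ker_le _ _ (hker ι).le p⟩
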